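/- Let $T$ be a compactly generated triangulated category with set-indexed coproducts and suspension $\Sigma$, let $R=\bigoplus_{n\in\mathbb Z}R_n$ be a $\mathbb Z$-graded ring that is noetherian and graded-commutative ($rs=(-1)^{|r||s|}sr$ for homogeneous $r,s$), and let $R$ act on $T$ through a homomorphism of graded rings $R\to Z^*(T)$ to the graded centre, where $Z^n(T)=\{\eta\colon \mathrm{Id}_T\to\Sigma^n\mid \eta\Sigma=(-1)^n\Sigma\eta\}$. Thus $\mathrm{Hom}^*_T(C,X)=\bigoplus_{n}\mathrm{Hom}_T(C,\Sigma^nX)$ is a graded $R$-module for all objects $C,X$. A *localising subcategory* of $T$ is a full triangulated subcategory closed under set-indexed coproducts; $\mathrm{Loc}_T(\mathcal C)$ is the smallest one containing the class of objects $\mathcal C$. Let $\mathrm{Spec}\,R$ be the set of homogeneous prime ideals of $R$. For a specialisation closed subset $V\subseteq\mathrm{Spec}\,R$ let $T_V$ be the localising subcategory of those $X$ with $\mathrm{Hom}^*_T(C,X)_{\mathfrak p}=0$ for all compact $C$ and all $\mathfrak p\in\mathrm{Spec}\,R\setminus V$, and let $\Gamma_VX\to X\to L_VX\to\Sigma\Gamma_VX$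 be the associated localisation triangle: the exact triangle, unique up to isomorphism, with $\Gamma_VX\in T_V$ and $\mathrm{Hom}_T(Y,L_VX)=0$ for all $Y\in T_V$. For $\mathfrak p\in\mathrm{Spec}\,R$ put $\mathcal V(\mathfrak p)=\{\mathfrak q\mid\mathfrak p\subseteq\mathfrak q\}$, $\mathcal Z(\mathfrak p)=\{\mathfrak q\mid\mathfrak q\not\subseteq\mathfrak p\}$ and $\Gamma_{\mathfrak p}X=\Gamma_{\mathcal V(\mathfrak p)}(L_{\mathcal Z(\mathfrak p)}X)$, let $\Gamma_{\mathfrak p}T$ be the essential image of $\Gamma_{\mathfrak p}$, and let $\mathrm{supp}_RT=\{\mathfrak p\in\mathrm{Spec}\,R\mid\Gamma_{\mathfrak p}T\neq0\}$. Assume the *local-global principle*: for each object $X$ of $T$, $\mathrm{Loc}_T(X)=\mathrm{Loc}_T(\Gamma_{\mathfrak p}X\mid\mathfrak p\in\mathrm{Spec}\,R)$. Then the assignments $$\sigma(S)=(S\cap\Gamma_{\mathfrak p}T)_{\mathfrak p\in\mathrm{supp}_RT},\qquad \tau\big((S(\mathfrak p))_{\mathfrak p\in\mathrm{supp}_RT}\big)=\mathrm{Loc}_T\big(S(\mathfrak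 p)\mid\mathfrak p\in\mathrm{supp}_RT\big)$$ are well-defined, mutually inverse, inclusion-preserving bijections between the localising subcategories of $T$ and the families $(S(\mathfrak p))_{\mathfrak p\in\mathrm{supp}_RT}$ in which each $S(\mathfrak p)$ is a localising subcategory of $\Gamma_{\mathfrak p}T$ (families being ordered componentwise by inclusion). -/

import Mathlib

open CategoryTheory CategoryTheory.Limits CategoryTheory.Pretriangulated

universe w v u

namespace RLinearTriangulated

section GradedRings

variable {R : Type w} [Ring R] (𝒜 : ℤ → AddSubgroup R) [GradedRing 𝒜]

/-- A `ℤ`-graded ring is graded-commutative when `r s = (-1)^(|r||s|) s r` for all homogeneous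
elements `r`, `s`. -/
def GradedCommutative : Prop :=
  ∀ (m n : ℤ) (r s : R), r ∈ 𝒜 m → s ∈ 𝒜 n → r * s = (m * n).negOnePow • (s * r)

/-- `Spec R` for a graded-commutative ring `R`: the homogeneous prime ideals. (In a
graded-commutative ring each homogeneous left ideal is two-sided.) -/
structure HomogeneousSpec where
  /-- the underlying homogeneous ideal -/
  ideal : HomogeneousIdeal 𝒜
  one_notMem : (1 : R) ∉ ideal
  mem_or_mem : ∀ (m n : ℤ) (r s : R), r ∈ 𝒜 m → s ∈ 𝒜 n →
    r * s ∈ ideal → r ∈ ideal ∨ s ∈ ideal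

variable {𝒜}

/-- The closed set `𝒱(𝔭)` of the homogeneous primes that contain `𝔭`. -/
def primesAbove (p : HomogeneousSpec 𝒜) : Set (HomogeneousSpec 𝒜) :=
  {q | p.ideal ≤ q.ideal}

/-- The specialisation closed set `𝒵(𝔭)` of the homogeneous primes not contained in `𝔭`. -/
def primesNotBelow (p : HomogeneousSpec 𝒜) : Set (HomogeneousSpec 𝒜) :=
  {q | ¬ q.ideal ≤ p.ideal}

end GradedRings

variable (T : Type u) [Category.{v} T] [Preadditive T] [HasShift T ℤ]

/-- The degree `n` component of the graded centre: the natural transformations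
`η : Id ⟶ Σⁿ` with `η Σ = (-1)ⁿ Σ η`, where `ΣⁿΣ` and `ΣΣⁿ` are identified by the canonical
isomorphism. -/
def gradedCentre [(shiftFunctor T (1 : ℤ)).Additive] (n : ℤ) :
    AddSubgroup (𝟭 T ⟶ shiftFunctor T n) where
  carrier := {η | ∀ X : T,
    η.app (X⟦(1 : ℤ)⟧) = n.negOnePow • ((η.app X)⟦(1 : ℤ)⟧' ≫ (shiftComm X n (1 : ℤ)).hom)}
  zero_mem' X := by simp
  add_mem' {a b} ha hb X := by
    have h : (a + b).app X = a.app X + b.app X := rfl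
    have h' : (a + b).app (X⟦(1 : ℤ)⟧) = a.app (X⟦(1 : ℤ)⟧) + b.app (X⟦(1 : ℤ)⟧) := rfl
    rw [h, h', ha X, hb X, Functor.map_add, Preadditive.add_comp, smul_add]
  neg_mem' {a} ha X := by
    have h : (-a).app X = -a.app X := rfl
    have h' : (-a).app (X⟦(1 : ℤ)⟧) = -a.app (X⟦(1 : ℤ)⟧) := rfl
    rw [h, h', ha X, Functor.map_neg, Preadditive.neg_comp, smul_neg]

/-- The component at `X` of an element of degree `n` of the graded centre, as an element of
`Endⁿ(X) = Hom(X, Σⁿ X)`. -/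
def gradedCentreAt [(shiftFunctor T (1 : ℤ)).Additive] {n : ℤ} (η : gradedCentre T n)
    (X : T) : ShiftedHom X X n :=
  η.1.app X

/-- An action of the graded ring `R = ⨁ₙ 𝒜 n` on `T`: a homomorphism of graded rings from `R`
to the graded centre of `T`, given by its homogeneous components. The product in the graded
centre is computed objectwise in `End*(X)`, in which `g · f` is `f` followed by `g`. -/
structure CentralAction [(shiftFunctor T (1 : ℤ)).Additive]
    {R : Type w} [Ring R] (𝒜 : ℤ → AddSubgroup R) [GradedRing 𝒜] where
  /-- the homogeneous components of the homomorphism -/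
  toFun (n : ℤ) : 𝒜 n →+ gradedCentre T n
  map_one (X : T) :
    gradedCentreAt T (toFun 0 ⟨1, SetLike.GradedOne.one_mem⟩) X = (shiftFunctorZero T ℤ).inv.app X
  map_mul (m n : ℤ) (r : 𝒜 m) (s : 𝒜 n) (X : T) :
    gradedCentreAt T (toFun (m + n) ⟨r.1 * s.1, SetLike.GradedMul.mul_mem r.2 s.2⟩) X =
      ShiftedHom.comp (gradedCentreAt T (toFun n s) X) (gradedCentreAt T (toFun m r) X) rfl

variable {T}

section Subcategories

variable [HasZeroObject T] [∀ n : ℤ, (shiftFunctor T n).Additive] [Pretriangulated T]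

/-- A localising subcategory: a (strictly) full triangulated subcategory that is closed under
all set-indexed coproducts. -/
structure IsLocalising (S : ObjectProperty T) : Prop where
  isTriangulated : S.IsTriangulated
  isClosedUnderIsomorphisms : S.IsClosedUnderIsomorphisms
  isClosedUnderCoproducts : ∀ J : Type v, S.IsClosedUnderColimitsOfShape (Discrete J)

variable (T) in
/-- The localising subcategories of `T`, ordered by inclusion. -/
abbrev LocalisingSubcategory : Type u := {S : ObjectProperty T // IsLocalising S}

/-- For a localising subcategory `P` of `T`, the localising subcategories of `P`, ordered by
inclusion. Triangles and coproducts of `P` being those of `T`, these are the localising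
subcategories of `T` contained in `P`. -/
abbrev LocalisingSubcategoryOf (P : ObjectProperty T) : Type u :=
  {S : ObjectProperty T // IsLocalising S ∧ S ≤ P}

/-- `Loc(P)`: the smallest localising subcategory that contains the class of objects `P`. -/
def loc (P : ObjectProperty T) : ObjectProperty T :=
  fun X => ∀ S : ObjectProperty T, IsLocalising S → P ≤ S → S X

end Subcategories

/-- An object `C` is compact when each morphism from `C` to a set-indexed coproduct factors
through a finite subcoproduct. -/
def IsCompactObj [HasCoproducts.{v} T] (C : T) : Prop :=
  ∀ (J : Type v) (Y : J → T) (f : C ⟶ ∐ Y), ∃ (s : Finset J) (g : C ⟶ ∐ fun j : s => Y j),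
    g ≫ Sigma.desc (fun j : s => Sigma.ι Y j) = f

variable (T) in
/-- `T` is compactly generated: `T = Loc(G)` for some set `G` of compact objects. -/
def CompactlyGenerated [HasCoproducts.{v} T] [HasZeroObject T]
    [∀ n : ℤ, (shiftFunctor T n).Additive] [Pretriangulated T] : Prop :=
  ∃ (ι : Type v) (G : ι → T), (∀ i, IsCompactObj (G i)) ∧
    loc (ObjectProperty.ofObj G) = ⊤

section LocalCohomology

variable [HasCoproducts.{v} T] [HasZeroObject T] [∀ n : ℤ, (shiftFunctor T n).Additive]
  [Pretriangulated T] {R : Type w} [Ring R] {𝒜 : ℤ → AddSubgroup R} [GradedRing 𝒜]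
  (ρ : CentralAction T 𝒜)

/-- The action of a homogeneous element `r` of degree `m` on `f ∈ Homⁿ(C, X) = Hom(C, Σⁿ X)`. -/
noncomputable def CentralAction.act {m : ℤ} (r : 𝒜 m) {C X : T} {n : ℤ} (f : ShiftedHom C X n) :
    ShiftedHom C X (m + n) :=
  f.comp (gradedCentreAt T (ρ.toFun m r) X) rfl

/-- `Hom*(C, X)_𝔭 = 0`: the homogeneous localisation at `𝔭` of the graded `R`-module
`Hom*(C, X)` vanishes, i.e. each homogeneous element is annihilated by some homogeneous
element outside `𝔭`. -/
def HomLocalisationVanishes (p : HomogeneousSpec 𝒜) (C X : T) : Prop :=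
  ∀ (n : ℤ) (f : ShiftedHom C X n), ∃ (m : ℤ) (r : 𝒜 m), r.1 ∉ p.ideal ∧ ρ.act r f = 0

/-- The `V`-torsion objects: those `X` with `Hom*(C, X)_𝔭 = 0` for all compact `C` and all
`𝔭 ∉ V`. -/
def torsion (V : Set (HomogeneousSpec 𝒜)) : ObjectProperty T :=
  fun X => ∀ C : T, IsCompactObj C → ∀ p : HomogeneousSpec 𝒜, p ∉ V →
    HomLocalisationVanishes ρ p C X

/-- `G ⟶ X ⟶ L ⟶` is, up to isomorphism, the localisation triangle
`Γ_V X ⟶ X ⟶ L_V X ⟶` of `X` for a specialisation closed set `V`: it is an exact triangle in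
which `G` is `V`-torsion and `L` lies in the right orthogonal of the `V`-torsion objects. (Such
a triangle is unique up to unique isomorphism. As the `V`-torsion objects are closed under
suspensions, the orthogonal needs no mention of them.) -/
def IsLocalisationTriangle (V : Set (HomogeneousSpec 𝒜)) (G X L : T) : Prop :=
  torsion ρ V G ∧ (torsion ρ V).rightOrthogonal L ∧
    ∃ (a : G ⟶ X) (b : X ⟶ L) (c : L ⟶ G⟦(1 : ℤ)⟧), Triangle.mk a b c ∈ distTriang T

/-- `Y ≅ L_V X`. -/
def IsLocalisationOf (V : Set (HomogeneousSpec 𝒜)) (X Y : T) : Prop :=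
  ∃ G : T, IsLocalisationTriangle ρ V G X Y

/-- `Y ≅ Γ_V X`, for the local cohomology functor `Γ_V`. -/
def IsColocalisationOf (V : Set (HomogeneousSpec 𝒜)) (X Y : T) : Prop :=
  ∃ L : T, IsLocalisationTriangle ρ V Y X L

/-- `Y ≅ Γ_𝔭 X`, where `Γ_𝔭 X = Γ_{𝒱(𝔭)} (X_𝔭)` and `X_𝔭 = L_{𝒵(𝔭)} X`. -/
def IsGamma (p : HomogeneousSpec 𝒜) (X Y : T) : Prop :=
  ∃ Xp : T, IsLocalisationOf ρ (primesNotBelow p) X Xp ∧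
    IsColocalisationOf ρ (primesAbove p) Xp Y

/-- `Γ_𝔭 T`, the essential image of `Γ_𝔭`. -/
def gammaImage (p : HomogeneousSpec 𝒜) : ObjectProperty T :=
  fun Y => ∃ X : T, IsGamma ρ p X Y

/-- `supp_R T = {𝔭 ∈ Spec R ∣ Γ_𝔭 T ≠ 0}`. -/
def supp : Set (HomogeneousSpec 𝒜) :=
  {p | ∃ Y : T, gammaImage ρ p Y ∧ ¬ IsZero Y}

/-- The local-global principle: for each object `X`, the localising subcategory generated by
`X` is the one generated by the objects `Γ_𝔭 X` with `𝔭 ∈ Spec R`. -/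
def LocalGlobalPrinciple : Prop :=
  ∀ X : T, loc (ObjectProperty.singleton X) =
    loc (fun Y : T => ∃ p : HomogeneousSpec 𝒜, IsGamma ρ p X Y)

end LocalCohomology

end RLinearTriangulated

/-! `Γ_𝔭 T` consists of the objects that are both `𝒱(𝔭)`-torsion and `𝔭`-local, i.e. right
orthogonal to the `𝒵(𝔭)`-torsion objects (`gammaImage_eq`). It is localising because the
`𝒵(𝔭)`-torsion objects are detected by a set of compact torsion objects, which makes their right
orthogonal closed under coproducts (`rightOrthogonal_of_gradedOrthogonal`,
`isLocalising_of_generators`). So `σ` is well defined, and `τσ = id` is the local-global principle: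
for `X` in `S`, each `Γ_𝔭 X` lies in `Loc(X) ⊆ S`.

The substance is `στ = id` (`loc_inf_gammaImage_le`): an object of `Γ_𝔭 T` built from `S(𝔭)` and
from the `Γ_𝔮 T` with `𝔮 ≠ 𝔭` must lie in `S(𝔭)`. Instead of applying `Γ_𝔭` as a functor, one takes
the class `A * S(𝔭) * C` of iterated extensions, where `A` is the `𝒵(𝔭)`-torsion and `C` the
`𝔭`-local objects right orthogonal to the `𝒱(𝔭)`-torsion. As no nonzero morphisms go from left
factors to right factors, this class is localising (`isLocalising_extensionProduct`). It contains
`Γ_𝔮 T`: inside `A` if `𝔮 ⊄ 𝔭`, inside `C` if `𝔮 ⊊ 𝔭`. An object of it that is `𝔭`-local has no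
`A`-part, and if it is also `𝒱(𝔭)`-torsion it has no `C`-part.

That `C` is localising needs enough compact `𝒱(𝔭)`-torsion objects. These are the Koszul objects
(`exists_koszul`); that they suffice is an associated-prime argument over the noetherian ring. -/

namespace RLinearTriangulated

open ZeroObject

/-! ### Localising subcategories and orthogonals -/

section Localising

variable {T : Type u} [Category.{v} T]

lemma isClosedUnderColimitsOfShape_discrete {J : Type*} [HasColimitsOfShape (Discrete J) T]
    {S : ObjectProperty T} [S.IsClosedUnderIsomorphisms]
    (h : ∀ Y : J → T, (∀ j, S (Y j)) → S (∐ Y)) :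
    S.IsClosedUnderColimitsOfShape (Discrete J) where
  colimitsOfShape_le _ := fun ⟨p⟩ =>
    S.prop_of_iso
      ((HasColimit.isoOfNatIso (Discrete.natIsoFunctor (F := p.diag))).symm ≪≫
        (colimit.isColimit _).coconePointUniqueUpToIso p.isColimit)
      (h (fun j => p.diag.obj ⟨j⟩) fun j => p.prop_diag_obj ⟨j⟩)

lemma rightOrthogonal_antitone [HasZeroMorphisms T] {P Q : ObjectProperty T} (h : P ≤ Q) :
    Q.rightOrthogonal ≤ P.rightOrthogonal :=
  fun _ hY _ f hX => hY f (h _ hX)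

lemma prop_sigma {J : Type*} [HasColimitsOfShape (Discrete J) T]
    (S : ObjectProperty T) [S.IsClosedUnderColimitsOfShape (Discrete J)] (Y : J → T)
    (h : ∀ j, S (Y j)) : S (∐ Y) :=
  S.prop_colimit _ fun j => h j.as

variable [Preadditive T] [HasShift T ℤ] [HasZeroObject T] [∀ n : ℤ, (shiftFunctor T n).Additive]
  [Pretriangulated T]

namespace IsLocalising

variable {S S' : ObjectProperty T}

lemma inf (h : IsLocalising S) (h' : IsLocalising S') : IsLocalising (S ⊓ S') := by
  have := h.isTriangulated
  have := h'.isTriangulated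
  have := h.isClosedUnderIsomorphisms
  have := h'.isClosedUnderIsomorphisms
  have := h.isClosedUnderCoproducts
  have := h'.isClosedUnderCoproducts
  exact ⟨inferInstance, inferInstance, fun J => ⟨fun X hX =>
    ⟨ObjectProperty.IsClosedUnderColimitsOfShape.colimitsOfShape_le _ _ _
        (ObjectProperty.colimitsOfShape_monotone _ inf_le_left _ hX),
      ObjectProperty.IsClosedUnderColimitsOfShape.colimitsOfShape_le _ _ _
        (ObjectProperty.colimitsOfShape_monotone _ inf_le_right _ hX)⟩⟩⟩

lemma prop_of_iso (h : IsLocalising S) {X Y : T} (e : X ≅ Y) (hX : S X) : S Y :=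
  have := h.isClosedUnderIsomorphisms
  S.prop_of_iso e hX

lemma prop_of_isZero (h : IsLocalising S) {X : T} (hX : IsZero X) : S X := by
  have := h.isClosedUnderIsomorphisms
  have := h.isTriangulated
  exact S.prop_of_isZero hX

lemma prop_shift (h : IsLocalising S) {X : T} (hX : S X) (n : ℤ) : S (X⟦n⟧) :=
  have := h.isTriangulated
  S.le_shift n _ hX

lemma prop_sigma [HasCoproducts.{v} T] (h : IsLocalising S) {J : Type v} (Y : J → T)
    (hY : ∀ j, S (Y j)) : S (∐ Y) :=
  have := h.isClosedUnderCoproducts J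
  RLinearTriangulated.prop_sigma S Y hY

lemma ext₂ (h : IsLocalising S) {t : Triangle T} (ht : t ∈ distTriang T)
    (h₁ : S t.obj₁) (h₃ : S t.obj₃) : S t.obj₂ :=
  have := h.isTriangulated
  have := h.isClosedUnderIsomorphisms
  S.ext_of_isTriangulatedClosed₂ t ht h₁ h₃

lemma ext₃ (h : IsLocalising S) {t : Triangle T} (ht : t ∈ distTriang T)
    (h₁ : S t.obj₁) (h₂ : S t.obj₂) : S t.obj₃ :=
  have := h.isTriangulated
  have := h.isClosedUnderIsomorphisms
  S.ext_of_isTriangulatedClosed₃ t ht h₁ h₂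

end IsLocalising

lemma le_loc (P : ObjectProperty T) : P ≤ loc P :=
  fun _ hX _ _ hS => hS _ hX

lemma loc_le {P S : ObjectProperty T} (hS : IsLocalising S) (h : P ≤ S) : loc P ≤ S :=
  fun _ hX => hX S hS h

lemma loc_mono {P Q : ObjectProperty T} (h : P ≤ Q) : loc P ≤ loc Q :=
  fun _ hX S hS hQ => hX S hS (h.trans hQ)

lemma isLocalising_loc (P : ObjectProperty T) : IsLocalising (loc P) := by
  have hiso : (loc P).IsClosedUnderIsomorphisms :=
    ⟨fun e hX S hS hP => hS.prop_of_iso e (hX S hS hP)⟩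
  refine ⟨?_, hiso, fun J => ⟨fun X hX S hS hP => ?_⟩⟩
  · have h₀ : (loc P).ContainsZero :=
      ⟨0, isZero_zero T, fun S hS _ => hS.prop_of_isZero (isZero_zero T)⟩
    have h₁ : (loc P).IsStableUnderShift ℤ :=
      ⟨fun n => ⟨fun X hX S hS hP => hS.prop_shift (hX S hS hP) n⟩⟩
    have h₂ : (loc P).IsTriangulatedClosed₂ :=
      .mk' fun t ht h₁ h₃ S hS hP => hS.ext₂ ht (h₁ S hS hP) (h₃ S hS hP)
    exact {}
  · have := hS.isClosedUnderCoproducts J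
    exact ObjectProperty.IsClosedUnderColimitsOfShape.colimitsOfShape_le _ _ _
      (ObjectProperty.colimitsOfShape_monotone _ (loc_le hS hP) _ hX)

lemma isLocalising_rightOrthogonal [HasCoproducts.{v} T] (P : ObjectProperty T)
    [P.IsStableUnderShift ℤ]
    (h : ∀ (J : Type v) (Y : J → T), (∀ j, P.rightOrthogonal (Y j)) → P.rightOrthogonal (∐ Y)) :
    IsLocalising P.rightOrthogonal :=
  ⟨inferInstance, inferInstance, fun J => isClosedUnderColimitsOfShape_discrete (h J)⟩

end Localising

/-! ### Exactness properties of distinguished triangles -/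

section Triangles

variable {T : Type u} [Category.{v} T] [Preadditive T] [HasShift T ℤ] [HasZeroObject T]
  [∀ n : ℤ, (shiftFunctor T n).Additive] [Pretriangulated T]
  {X Y Z : T} {f : X ⟶ Y} {g : Y ⟶ Z} {h : Z ⟶ X⟦(1 : ℤ)⟧}

lemma exists_of_mor₁_comp_eq_zero (ht : Triangle.mk f g h ∈ distTriang T) {W : T} (k : Y ⟶ W)
    (hk : f ≫ k = 0) : ∃ l, k = g ≫ l :=
  Triangle.yoneda_exact₂ _ ht k hk

lemma exists_of_mor₂_comp_eq_zero (ht : Triangle.mk f g h ∈ distTriang T) {W : T} (k : Z ⟶ W)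
    (hk : g ≫ k = 0) : ∃ l, k = h ≫ l :=
  Triangle.yoneda_exact₃ _ ht k hk

lemma exists_of_mor₃_comp_eq_zero (ht : Triangle.mk f g h ∈ distTriang T) {W : T}
    (k : X⟦(1 : ℤ)⟧ ⟶ W) (hk : h ≫ k = 0) : ∃ l, k = f⟦(1 : ℤ)⟧' ≫ l := by
  obtain ⟨l, hl⟩ : ∃ l : Y⟦(1 : ℤ)⟧ ⟶ W, k = (-f⟦(1 : ℤ)⟧') ≫ l :=
    Triangle.yoneda_exact₃ _ (rot_of_distTriang _ ht) k hk
  exact ⟨-l, by rw [hl, Preadditive.neg_comp, Preadditive.comp_neg]⟩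

lemma exists_of_comp_mor₁_eq_zero (ht : Triangle.mk f g h ∈ distTriang T) {W : T}
    (k : W ⟶ X⟦(1 : ℤ)⟧) (hk : k ≫ f⟦(1 : ℤ)⟧' = 0) : ∃ l, k = l ≫ h :=
  Triangle.coyoneda_exact₁ _ ht k hk

lemma exists_of_comp_mor₂_eq_zero (ht : Triangle.mk f g h ∈ distTriang T) {W : T} (k : W ⟶ Y)
    (hk : k ≫ g = 0) : ∃ l, k = l ≫ f :=
  Triangle.coyoneda_exact₂ _ ht k hk

lemma exists_of_comp_mor₃_eq_zero (ht : Triangle.mk f g h ∈ distTriang T) {W : T} (k : W ⟶ Z)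
    (hk : k ≫ h = 0) : ∃ l, k = l ≫ g :=
  Triangle.coyoneda_exact₃ _ ht k hk

lemma distinguished_of_iso₃ (ht : Triangle.mk f g h ∈ distTriang T) {Z' : T} {g' : Y ⟶ Z'}
    {h' : Z' ⟶ X⟦(1 : ℤ)⟧} (e : Z ≅ Z') (hg : g ≫ e.hom = g') (hh : e.hom ≫ h' = h) :
    Triangle.mk f g' h' ∈ distTriang T := by
  subst hg hh
  refine isomorphic_distinguished _ ht _ (Iso.symm (Triangle.isoMk _ _ (Iso.refl _) (Iso.refl _)
    e ?_ ?_ ?_))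
  · exact (Category.comp_id f).trans (Category.id_comp f).symm
  · exact (Category.id_comp (g ≫ e.hom)).symm
  · change (e.hom ≫ h') ≫ (𝟙 X)⟦(1 : ℤ)⟧' = e.hom ≫ h'
    rw [CategoryTheory.Functor.map_id, Category.comp_id]

lemma isIso₁_of_isZero₃ (ht : Triangle.mk f g h ∈ distTriang T) (hZ : IsZero Z) : IsIso f :=
  (Triangle.isZero₃_iff_isIso₁ _ ht).1 hZ

lemma isIso₂_of_isZero₁ (ht : Triangle.mk f g h ∈ distTriang T) (hX : IsZero X) : IsIso g :=
  (Triangle.isZero₁_iff_isIso₂ _ ht).1 hX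

end Triangles

/-! ### Coproducts of distinguished triangles -/

section Coproducts

variable {T : Type u} [Category.{v} T] [HasShift T ℤ] {J : Type*}
  [HasColimitsOfShape (Discrete J) T]

lemma shift_sigma_hom_ext {Y : J → T} {n : ℤ} {W : T} {f g : (∐ Y)⟦n⟧ ⟶ W}
    (h : ∀ j, (Sigma.ι Y j)⟦n⟧' ≫ f = (Sigma.ι Y j)⟦n⟧' ≫ g) : f = g :=
  Cofan.IsColimit.hom_ext
    (isColimitCofanMkObjOfIsColimit (shiftFunctor T n) Y _ (coproductIsCoproduct Y)) f g h

lemma exists_shift_sigma_desc {Y : J → T} {n : ℤ} {W : T} (k : ∀ j, (Y j)⟦n⟧ ⟶ W) :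
    ∃ f : (∐ Y)⟦n⟧ ⟶ W, ∀ j, (Sigma.ι Y j)⟦n⟧' ≫ f = k j :=
  let hc := isColimitCofanMkObjOfIsColimit (shiftFunctor T n) Y _ (coproductIsCoproduct Y)
  ⟨Cofan.IsColimit.desc hc k, fun j => Cofan.IsColimit.fac hc k j⟩

variable [Preadditive T] [HasZeroObject T] [∀ n : ℤ, (shiftFunctor T n).Additive]
  [Pretriangulated T]

/-- A coproduct of distinguished triangles is distinguished. -/
lemma exists_distinguished_sigma {X Y Z : J → T} {x : ∀ j, X j ⟶ Y j} {y : ∀ j, Y j ⟶ Z j}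
    {z : ∀ j, Z j ⟶ (X j)⟦(1 : ℤ)⟧} (ht : ∀ j, Triangle.mk (x j) (y j) (z j) ∈ distTriang T) :
    ∃ (f : ∐ X ⟶ ∐ Y) (g : ∐ Y ⟶ ∐ Z) (h : ∐ Z ⟶ (∐ X)⟦(1 : ℤ)⟧),
      Triangle.mk f g h ∈ distTriang T := by
  let f : ∐ X ⟶ ∐ Y := Limits.Sigma.map x
  have hf (j : J) : x j ≫ Sigma.ι Y j = Sigma.ι X j ≫ f := (Sigma.ι_map x j).symm
  obtain ⟨C, f₂, f₃, hC⟩ := distinguished_cocone_triangle f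
  have hφ (j : J) : ∃ φ : Z j ⟶ C, y j ≫ φ = Sigma.ι Y j ≫ f₂ ∧
      z j ≫ (Sigma.ι X j)⟦(1 : ℤ)⟧' = φ ≫ f₃ :=
    complete_distinguished_triangle_morphism _ _ (ht j) hC _ _ (hf j)
  choose φ hφ₂ hφ₃ using hφ
  have h₃₁ : f₃ ≫ f⟦(1 : ℤ)⟧' = 0 := comp_distTriang_mor_zero₃₁ _ hC
  have hxy (j : J) : x j ≫ y j = 0 := comp_distTriang_mor_zero₁₂ _ (ht j)
  -- A five lemma by hand: the comparison from `∐ Z` to the cone `C` is bijective on `Hom(-, W)`, by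
  -- chasing the exact sequences of the single triangles and assembling the results over `j`.
  have hiso : IsIso (Sigma.desc φ) := by
    refine isIso_of_coyoneda_map_bijective _ fun W => ⟨?_, fun c => ?_⟩
    · suffices h : ∀ a : C ⟶ W, Sigma.desc φ ≫ a = 0 → a = 0 by
        intro a b hab
        rw [← sub_eq_zero]
        exact h _ (by simpa [sub_eq_zero] using hab)
      intro a ha
      have ha' (j : J) : φ j ≫ a = 0 := by
        rw [← Sigma.ι_desc φ j, Category.assoc, ha, comp_zero]
      obtain ⟨b, hb⟩ := exists_of_mor₂_comp_eq_zero hC a (Sigma.hom_ext _ _ fun j => by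
        rw [← reassoc_of% hφ₂ j, ha', comp_zero, comp_zero])
      have hc (j : J) : ∃ c : (Y j)⟦(1 : ℤ)⟧ ⟶ W,
          (Sigma.ι X j)⟦(1 : ℤ)⟧' ≫ b = (x j)⟦(1 : ℤ)⟧' ≫ c :=
        exists_of_mor₃_comp_eq_zero (ht j) _ (by rw [reassoc_of% hφ₃ j, ← hb, ha'])
      choose c hc using hc
      obtain ⟨d, hd⟩ := exists_shift_sigma_desc c
      have hbd : b = f⟦(1 : ℤ)⟧' ≫ d := shift_sigma_hom_ext fun j => by
        rw [hc, ← hd, ← Functor.map_comp_assoc, ← Functor.map_comp_assoc, hf]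
      rw [hb, hbd, reassoc_of% h₃₁, zero_comp]
    · obtain ⟨a, ha⟩ := exists_of_mor₁_comp_eq_zero hC
        (Sigma.desc fun j => y j ≫ Sigma.ι Z j ≫ c)
        (Sigma.hom_ext _ _ fun j => by
          rw [← reassoc_of% hf j, Sigma.ι_desc, reassoc_of% hxy j, zero_comp, comp_zero])
      have ha' (j : J) : Sigma.ι Y j ≫ f₂ ≫ a = y j ≫ Sigma.ι Z j ≫ c := by
        rw [← ha, Sigma.ι_desc]
      have hd (j : J) : ∃ d, Sigma.ι Z j ≫ c - φ j ≫ a = z j ≫ d :=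
        exists_of_mor₂_comp_eq_zero (ht j) _ (by
          rw [Preadditive.comp_sub, reassoc_of% hφ₂ j, ha', sub_self])
      choose d hd using hd
      obtain ⟨e, he⟩ := exists_shift_sigma_desc d
      refine ⟨a + f₃ ≫ e, Sigma.hom_ext _ _ fun j => ?_⟩
      change Sigma.ι Z j ≫ Sigma.desc φ ≫ (a + f₃ ≫ e) = _
      rw [Sigma.ι_desc_assoc, Preadditive.comp_add, ← reassoc_of% hφ₃ j, he, ← hd]
      abel
  exact ⟨f, f₂ ≫ inv (Sigma.desc φ), Sigma.desc φ ≫ f₃, distinguished_of_iso₃ hC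
    (asIso (Sigma.desc φ)).symm rfl (by simp)⟩

end Coproducts

/-! ### Extension products of orthogonal localising subcategories -/

section Extensions

variable {T : Type u} [Category.{v} T] [Preadditive T] [HasShift T ℤ] [HasZeroObject T]
  [∀ n : ℤ, (shiftFunctor T n).Additive] [Pretriangulated T]

/-- An extension of an object of `P` by an object of `Q` can be rearranged when there are no
nonzero morphisms from `P` to `Q`. -/
lemma extensionProduct_swap {P Q : ObjectProperty T} (hP : IsLocalising P)
    (hPQ : Q ≤ P.rightOrthogonal) :
    ObjectProperty.extensionProduct Q P ≤ ObjectProperty.extensionProduct P Q := by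
  rintro X ⟨Y, Z, f, g, h, ht, hY, hZ⟩
  have := hP.isTriangulated
  -- The connecting morphism goes from an object of `P` to a suspension of an object of `Q`, so it
  -- vanishes and the triangle splits.
  have h0 : h = 0 := (P.rightOrthogonal.le_shift 1 _ (hPQ _ hY)) h hZ
  obtain ⟨e, -, -⟩ := exists_iso_binaryBiproduct_of_distTriang _ ht h0
  exact (ObjectProperty.extensionProduct P Q).prop_of_iso
    ((biprod.braiding _ _) ≪≫ e.symm)
    ⟨_, _, _, _, _, binaryBiproductTriangle_distinguished Z Y, hZ, hY⟩

/-- Associativity of extensions reduces extension closure to turning `P * Q * P * Q` into `P * P * Q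
* Q`, and orthogonality permits the swap of the middle factors. Coproducts are handled by coproducts
of triangles. -/
lemma isLocalising_extensionProduct [HasCoproducts.{v} T] [IsTriangulated T]
    {P Q : ObjectProperty T}
    (hP : IsLocalising P) (hQ : IsLocalising Q) (hPQ : Q ≤ P.rightOrthogonal) :
    IsLocalising (ObjectProperty.extensionProduct P Q) := by
  have := hP.isTriangulated
  have := hQ.isTriangulated
  have := hP.isClosedUnderIsomorphisms
  have := hQ.isClosedUnderIsomorphisms
  have h₀ : (ObjectProperty.extensionProduct P Q).ContainsZero :=
    ⟨0, isZero_zero T, ObjectProperty.le_extensionProduct_left _ _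
      (hP.prop_of_isZero (isZero_zero T))⟩
  have h₂ : (ObjectProperty.extensionProduct P Q).IsTriangulatedClosed₂ := by
    refine .mk' fun t ht h₁ h₃ => ?_
    have h : ObjectProperty.extensionProduct (ObjectProperty.extensionProduct P Q)
        (ObjectProperty.extensionProduct P Q) ≤ ObjectProperty.extensionProduct P Q := by
      rw [ObjectProperty.extensionProduct_assoc, ← ObjectProperty.extensionProduct_assoc Q P Q]
      refine (ObjectProperty.monotone_extensionProduct_right _
        (ObjectProperty.monotone_extensionProduct_left _ (extensionProduct_swap hP hPQ))).trans ?_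
      rw [ObjectProperty.extensionProduct_assoc, ← ObjectProperty.extensionProduct_assoc P P]
      exact (ObjectProperty.monotone_extensionProduct_left _
        (ObjectProperty.extensionProduct_le_of_isTriangulatedClosed₂ le_rfl le_rfl)).trans
        (ObjectProperty.monotone_extensionProduct_right _
          (ObjectProperty.extensionProduct_le_of_isTriangulatedClosed₂ le_rfl le_rfl))
    exact h _ ⟨_, _, _, _, _, ht, h₁, h₃⟩
  refine ⟨{}, inferInstance, fun J => isClosedUnderColimitsOfShape_discrete fun Y hY => ?_⟩
  choose A B f g h ht hA hB using hY
  obtain ⟨f', g', h', ht'⟩ := exists_distinguished_sigma ht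
  exact ⟨_, _, _, _, _, ht', hP.prop_sigma A hA, hQ.prop_sigma B hB⟩

/-- The `P`-part of `X` is itself right orthogonal to `P`, so its identity is zero. -/
lemma prop_right_of_extensionProduct {P Q : ObjectProperty T} (hP : IsLocalising P)
    (hQ : IsLocalising Q) (hPQ : Q ≤ P.rightOrthogonal) {X : T} (hX : P.rightOrthogonal X)
    (h : ObjectProperty.extensionProduct P Q X) : Q X := by
  obtain ⟨Y, Z, f, g, h, ht, hY, hZ⟩ := h
  have := hP.isTriangulated
  have hY' : P.rightOrthogonal Y :=
    P.rightOrthogonal.ext_of_isTriangulatedClosed₁ _ ht hX (hPQ _ hZ)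
  have : IsIso g := isIso₂_of_isZero₁ ht (by
    rw [IsZero.iff_id_eq_zero]
    exact hY' _ hY)
  exact hQ.prop_of_iso (asIso g).symm hZ

/-- The `Q`-part of `X` lies in `P'` and is right orthogonal to `P'`, hence is zero. In the
application `P` is `S(𝔭)` and `P'` the larger class of all `𝒱(𝔭)`-torsion objects. -/
lemma prop_left_of_extensionProduct {P Q : ObjectProperty T} (hP : IsLocalising P)
    {P' : ObjectProperty T} (hP' : IsLocalising P')
    (hPP' : P ≤ P') (hP'Q : Q ≤ P'.rightOrthogonal) {X : T} (hX : P' X)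
    (h : ObjectProperty.extensionProduct P Q X) : P X := by
  obtain ⟨Y, Z, f, g, h, ht, hY, hZ⟩ := h
  have hZ' : P' Z := hP'.ext₃ ht (hPP' _ hY) hX
  have : IsIso f := isIso₁_of_isZero₃ ht (by
    rw [IsZero.iff_id_eq_zero]
    exact hP'Q _ hZ _ hZ')
  exact hP.prop_of_iso (asIso f) hY

end Extensions

end RLinearTriangulated

namespace RLinearTriangulated

section Shift

variable {T : Type u} [Category.{v} T] [HasShift T ℤ]

lemma exists_eq_comp_shift_map {A B : T} {n : ℤ} (h : A ⟶ B⟦n⟧) :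
    ∃ g : A⟦-n⟧ ⟶ B, h = (shiftNegShift A n).inv ≫ g⟦n⟧' :=
  ⟨(shiftFunctor T n).preimage ((shiftNegShift A n).hom ≫ h), by simp⟩

end Shift

/-! ### Compact objects -/

section Compact

variable {T : Type u} [Category.{v} T] [Preadditive T] [HasCoproducts.{v} T]

/-- Having finite support, with no chosen factorisation, is the form of compactness that passes
easily to shifts and cones. -/
lemma isCompactObj_iff (C : T) : IsCompactObj C ↔
    ∀ (J : Type v) (Y : J → T) (f : C ⟶ ∐ Y), ∃ s : Finset J,
      ∀ (W : T) (g : ∐ Y ⟶ W), (∀ j ∈ s, Sigma.ι Y j ≫ g = 0) → f ≫ g = 0 := by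
  classical
  refine ⟨fun h J Y f => ?_, fun h J Y f => ?_⟩
  · obtain ⟨s, g, hg⟩ := h J Y f
    refine ⟨s, fun W k hk => ?_⟩
    rw [← hg, Category.assoc]
    have : Sigma.desc (fun j : s => Sigma.ι Y j) ≫ k = 0 :=
      Sigma.hom_ext _ _ fun j => by simpa using hk j j.2
    rw [this, comp_zero]
  · obtain ⟨s, hs⟩ := h J Y f
    let Q : ∐ Y ⟶ ∐ fun j : s => Y j :=
      Sigma.desc fun j => if hj : j ∈ s then Sigma.ι (fun j : s => Y j) ⟨j, hj⟩ else 0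
    refine ⟨s, f ≫ Q, ?_⟩
    have h0 := hs _ (Q ≫ Sigma.desc (fun j : s => Sigma.ι Y j) - 𝟙 _) fun j hj => by
      simp [Q, hj]
    rw [Preadditive.comp_sub, Category.comp_id, sub_eq_zero] at h0
    rw [Category.assoc, h0]

lemma IsCompactObj.exists_eq_sum {C : T} (hC : IsCompactObj C) {J : Type v} {Y : J → T}
    (f : C ⟶ ∐ Y) : ∃ (s : Finset J) (g : ∀ j, C ⟶ Y j), f = ∑ j ∈ s, g j ≫ Sigma.ι Y j := by
  classical
  obtain ⟨s, hs⟩ := (isCompactObj_iff C).1 hC J Y f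
  refine ⟨s, fun j => f ≫ Sigma.π Y j, ?_⟩
  have h := hs _ (𝟙 _ - ∑ j ∈ s, Sigma.π Y j ≫ Sigma.ι Y j) fun j hj => by
    rw [Preadditive.comp_sub, Category.comp_id, Preadditive.comp_sum,
      Finset.sum_eq_single_of_mem j hj, Sigma.ι_π_eq_id_assoc, sub_self]
    intro k _ hk
    rw [Sigma.ι_π_of_ne_assoc _ hk.symm, zero_comp]
  rw [Preadditive.comp_sub, Category.comp_id, sub_eq_zero, Preadditive.comp_sum] at h
  simpa only [Category.assoc] using h

variable [HasShift T ℤ] [∀ n : ℤ, (shiftFunctor T n).Additive]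

lemma IsCompactObj.shift {C : T} (hC : IsCompactObj C) (n : ℤ) : IsCompactObj (C⟦n⟧) := by
  rw [isCompactObj_iff] at hC ⊢
  intro J Y f
  let c := sigmaComparison (shiftFunctor T (-n)) Y
  obtain ⟨s, hs⟩ := hC J _ ((shiftShiftNeg C n).inv ≫ f⟦-n⟧' ≫ inv c)
  refine ⟨s, fun W g hg => ?_⟩
  have h := hs _ (c ≫ g⟦-n⟧') fun j hj => by
    rw [ι_comp_sigmaComparison_assoc, ← Functor.map_comp, hg j hj, Functor.map_zero]
  simp only [Category.assoc, IsIso.inv_hom_id_assoc, ← Functor.map_comp] at h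
  rw [Preadditive.IsIso.comp_left_eq_zero] at h
  exact (shiftFunctor T (-n)).map_eq_zero_iff.1 h

variable [HasZeroObject T] [Pretriangulated T]

lemma IsCompactObj.cone {C₁ C₂ C₃ : T} {a : C₁ ⟶ C₂} {b : C₂ ⟶ C₃} {c : C₃ ⟶ C₁⟦(1 : ℤ)⟧}
    (ht : Triangle.mk a b c ∈ distTriang T) (h₁ : IsCompactObj C₁) (h₂ : IsCompactObj C₂) :
    IsCompactObj C₃ := by
  classical
  have h₁' := h₁.shift 1
  rw [isCompactObj_iff] at h₁' h₂ ⊢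
  intro J Y f
  obtain ⟨s, hs⟩ := h₂ J Y (b ≫ f)
  -- `π` projects onto the summands in `s`. The remainder `f ≫ (𝟙 - π)` vanishes on `C₂`, so it
  -- factors through `C₁⟦1⟧`, which supplies a second finite support `t`.
  let π : ∐ Y ⟶ ∐ Y := Sigma.desc fun j => if j ∈ s then Sigma.ι Y j else 0
  obtain ⟨k, hk⟩ := exists_of_mor₂_comp_eq_zero ht (f ≫ (𝟙 _ - π)) (by
    rw [← Category.assoc]
    exact hs _ _ fun j hj => by simp [π, hj])
  obtain ⟨t, ht'⟩ := h₁' J Y k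
  refine ⟨s ∪ t, fun W g hg => ?_⟩
  have hπ : π ≫ g = 0 := Sigma.hom_ext _ _ fun j => by
    by_cases hj : j ∈ s
    · simpa [π, hj] using hg j (Finset.mem_union_left _ hj)
    · simp [π, hj]
  calc f ≫ g = (f ≫ (𝟙 _ - π)) ≫ g := by
        rw [Category.assoc, Preadditive.sub_comp, hπ, sub_zero, Category.id_comp]
    _ = 0 := by
        rw [hk, Category.assoc, ht' _ g fun j hj => hg j (Finset.mem_union_right _ hj), comp_zero]

end Compact

/-! ### Orthogonality tested on compact objects -/

section Generators

variable {T : Type u} [Category.{v} T] [Preadditive T] [HasShift T ℤ]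

/-- The objects `Y` with `Hom*(G j, Y) = 0` for all `j`. -/
def gradedOrthogonal {J : Type*} (G : J → T) : ObjectProperty T :=
  fun Y => ∀ (j : J) (n : ℤ) (f : (G j)⟦n⟧ ⟶ Y), f = 0

lemma gradedOrthogonal.eq_zero {J : Type*} {G : J → T} {Y : T}
    (hY : gradedOrthogonal G Y) {j : J} {n m : ℤ}
    (f : (G j)⟦n⟧⟦m⟧ ⟶ Y) : f = 0 := by
  rw [← cancel_epi ((shiftFunctorAdd T n m).hom.app (G j)), comp_zero]
  exact hY j (n + m) _

lemma gradedOrthogonal.eq_zero' {J : Type*} {G : J → T} {Y : T} (hY : gradedOrthogonal G Y) {j : J}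
    (f : G j ⟶ Y) : f = 0 := by
  rw [← cancel_epi ((shiftFunctorZero T ℤ).hom.app (G j)), comp_zero]
  exact hY j 0 _

variable [∀ n : ℤ, (shiftFunctor T n).Additive]

lemma gradedOrthogonal.shift {J : Type*} {G : J → T} {Y : T} (hY : gradedOrthogonal G Y) (m : ℤ) :
    gradedOrthogonal G (Y⟦m⟧) := by
  intro j n f
  obtain ⟨g, rfl⟩ := exists_eq_comp_shift_map f
  rw [hY.eq_zero g, Functor.map_zero, comp_zero]

lemma gradedOrthogonal_sigma [HasCoproducts.{v} T] {J : Type*} {G : J → T}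
    (hG : ∀ j, IsCompactObj (G j)) {I : Type v}
    (Y : I → T) (hY : ∀ i, gradedOrthogonal G (Y i)) : gradedOrthogonal G (∐ Y) := by
  intro j n f
  obtain ⟨s, g, rfl⟩ := ((hG j).shift n).exists_eq_sum f
  exact Finset.sum_eq_zero fun i _ => by rw [hY i j n (g i), zero_comp]

variable [HasZeroObject T] [Pretriangulated T] [HasCoproducts.{v} T]
  {J : Type v} {G : J → T} {P : ObjectProperty T}

/-- `W'` is the cone of the sum of all morphisms to `W` from all shifts of the `G j`; `f` extends to
it because it vanishes on those morphisms. -/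
lemma exists_extension_of_gradedOrthogonal (hP : IsLocalising P) (hGP : ∀ j, P (G j)) {W Y : T}
    (hW : P W) (hY : gradedOrthogonal G Y) (f : W ⟶ Y) :
    ∃ (W' : T) (i : W ⟶ W') (f' : W' ⟶ Y), P W' ∧ i ≫ f' = f ∧
      ∀ (j : J) (n : ℤ) (g : (G j)⟦n⟧ ⟶ W), g ≫ i = 0 := by
  let K (x : Σ (j : J) (n : ℤ), ((G j)⟦n⟧ ⟶ W)) : T := (G x.1)⟦x.2.1⟧
  let k : ∐ K ⟶ W := Sigma.desc fun x => x.2.2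
  obtain ⟨W', i, c, ht⟩ := distinguished_cocone_triangle k
  obtain ⟨f', hf'⟩ := exists_of_mor₁_comp_eq_zero ht f
    (Sigma.hom_ext _ _ fun x => by rw [comp_zero]; exact hY _ _ _)
  refine ⟨W', i, f', hP.ext₃ ht (hP.prop_sigma K fun x => hP.prop_shift (hGP _) _) hW,
    hf'.symm, fun j n g => ?_⟩
  have hki : k ≫ i = 0 := comp_distTriang_mor_zero₁₂ _ ht
  have hg : Sigma.ι K ⟨j, n, g⟩ ≫ k = g := Sigma.ι_desc _ _
  rw [← hg, Category.assoc, hki, comp_zero]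

/-- If a localising subcategory `P` contains compact objects `G j` that detect the vanishing of
objects in `P`, then the objects orthogonal to all `G j` are orthogonal to `P`. -/
theorem rightOrthogonal_of_gradedOrthogonal (hP : IsLocalising P) (hGP : ∀ j, P (G j))
    (hG : ∀ j, IsCompactObj (G j)) (h₀ : ∀ X, P X → gradedOrthogonal G X → IsZero X) {Y : T}
    (hY : gradedOrthogonal G Y) : P.rightOrthogonal Y := by
  intro X f hX
  have hstep (S : {S : Σ W : T, (W ⟶ Y) // P S.1}) :
      ∃ (S' : {S : Σ W : T, (W ⟶ Y) // P S.1}) (i : S.1.1 ⟶ S'.1.1), i ≫ S'.1.2 = S.1.2 ∧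
        ∀ (j : J) (n : ℤ) (g : (G j)⟦n⟧ ⟶ S.1.1), g ≫ i = 0 := by
    obtain ⟨W', i, f', hW', h⟩ := exists_extension_of_gradedOrthogonal hP hGP S.2 hY S.1.2
    exact ⟨⟨⟨W', f'⟩, hW'⟩, i, h⟩
  choose next i hf hi using hstep
  let S (k : ℕ) : {S : Σ W : T, (W ⟶ Y) // P S.1} := next^[k] ⟨⟨X, f⟩, hX⟩
  have hS (k : ℕ) : S (k + 1) = next (S k) := Function.iterate_succ_apply' _ _ _
  have hstep (k : ℕ) : ∃ i : (S k).1.1 ⟶ (S (k + 1)).1.1, i ≫ (S (k + 1)).1.2 = (S k).1.2 ∧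
      ∀ (j : J) (n : ℤ) (g : (G j)⟦n⟧ ⟶ (S k).1.1), g ≫ i = 0 := by
    rw [hS]
    exact ⟨i (S k), hf _, hi _⟩
  choose i hf hi using hstep
  -- Mapping telescope of `W 0 ⟶ W 1 ⟶ ⋯`: `θ` moves one step along the sequence and `L` is the cone
  -- of `𝟙 - θ`. By compactness, morphisms from the `(G j)⟦n⟧` die under `θ`. `ULift` only adjusts
  -- the universe.
  let W (k : ULift.{v} ℕ) : T := (S k.down).1.1
  let θ : ∐ W ⟶ ∐ W := Sigma.desc fun k => i k.down ≫ Sigma.ι W ⟨k.down + 1⟩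
  have hθ {j : J} {n : ℤ} (g : (G j)⟦n⟧ ⟶ ∐ W) : g ≫ θ = 0 := by
    obtain ⟨s, g, rfl⟩ := ((hG j).shift n).exists_eq_sum g
    rw [Preadditive.sum_comp]
    refine Finset.sum_eq_zero fun k _ => ?_
    rw [Category.assoc, Sigma.ι_desc, reassoc_of% hi k.down j n (g k), zero_comp]
  have hθ' {j : J} {n m : ℤ} (g : (G j)⟦n⟧⟦m⟧ ⟶ ∐ W) : g ≫ θ = 0 := by
    rw [← cancel_epi ((shiftFunctorAdd T n m).hom.app (G j)), comp_zero, ← Category.assoc]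
    exact hθ _
  obtain ⟨L, q, δ, ht⟩ := distinguished_cocone_triangle (𝟙 (∐ W) - θ)
  -- A morphism from `(G j)⟦n⟧` to `L` lifts to `∐ W`, where composing with `𝟙 - θ` changes nothing;
  -- so it vanishes in `L`.
  have hL : IsZero L := by
    have hW : P (∐ W) := hP.prop_sigma W fun k => (S k.down).2
    refine h₀ L (hP.ext₃ ht hW hW) fun j n g => ?_
    have hδ : δ ≫ (𝟙 (∐ W) - θ)⟦(1 : ℤ)⟧' = 0 := comp_distTriang_mor_zero₃₁ _ ht
    have hq : (𝟙 (∐ W) - θ) ≫ q = 0 := comp_distTriang_mor_zero₁₂ _ ht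
    have hgδ : g ≫ δ = 0 := by
      obtain ⟨k, hk⟩ := exists_eq_comp_shift_map (g ≫ δ)
      have h : (g ≫ δ) ≫ θ⟦(1 : ℤ)⟧' = 0 := by
        rw [hk, Category.assoc, ← Functor.map_comp, hθ', Functor.map_zero, comp_zero]
      have h' : (g ≫ δ) ≫ (𝟙 (∐ W) - θ)⟦(1 : ℤ)⟧' = 0 := by
        rw [Category.assoc, hδ, comp_zero]
      rwa [Functor.map_sub, CategoryTheory.Functor.map_id, Preadditive.comp_sub,
        Category.comp_id, h, sub_zero] at h'
    obtain ⟨l, rfl⟩ := exists_of_comp_mor₃_eq_zero ht g hgδ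
    have h : l ≫ (𝟙 (∐ W) - θ) = l := by
      rw [Preadditive.comp_sub, Category.comp_id, hθ, sub_zero]
    rw [← h, Category.assoc, hq, comp_zero]
  have := isIso₁_of_isZero₃ ht hL
  -- `F` gathers the successive extensions of `f`. Their compatibility says that `F` vanishes after
  -- `𝟙 - θ`, which is now invertible.
  let F : ∐ W ⟶ Y := Sigma.desc fun k => (S k.down).1.2
  have hF : F = 0 := by
    rw [← cancel_epi (𝟙 (∐ W) - θ), comp_zero]
    refine Sigma.hom_ext _ _ fun k => ?_
    rw [Preadditive.sub_comp, Category.id_comp, Preadditive.comp_sub, Sigma.ι_desc,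
      Sigma.ι_desc_assoc, Category.assoc, Sigma.ι_desc, hf, sub_self, comp_zero]
  have hf0 : Sigma.ι W ⟨0⟩ ≫ F = f := Sigma.ι_desc _ _
  have h0 : Sigma.ι W ⟨0⟩ ≫ F = 0 := by rw [hF, comp_zero]
  exact hf0.symm.trans h0

end Generators

end RLinearTriangulated

namespace RLinearTriangulated

/-! ### The central action and its signs -/

section Action

variable {T : Type u} [Category.{v} T] [Preadditive T] [HasShift T ℤ]
  [∀ n : ℤ, (shiftFunctor T n).Additive] {R : Type w} [Ring R] {𝒜 : ℤ → AddSubgroup R}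
  [GradedRing 𝒜] (ρ : CentralAction T 𝒜)

/-- The product of two homogeneous elements. -/
def homogeneousMul {m n : ℤ} (r : 𝒜 m) (s : 𝒜 n) : 𝒜 (m + n) :=
  ⟨r.1 * s.1, SetLike.GradedMul.mul_mem r.2 s.2⟩

namespace CentralAction

/-- The morphism `X ⟶ Σᵐ X` by which a homogeneous element of degree `m` acts. -/
def app {m : ℤ} (r : 𝒜 m) (X : T) : X ⟶ X⟦m⟧ :=
  (ρ.toFun m r).1.app X

lemma naturality {m : ℤ} (r : 𝒜 m) {X Y : T} (f : X ⟶ Y) :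
    f ≫ ρ.app r Y = ρ.app r X ≫ f⟦m⟧' :=
  (ρ.toFun m r).1.naturality f

lemma naturality_assoc {m : ℤ} (r : 𝒜 m) {X Y Z : T} (f : X ⟶ Y) (g : Y⟦m⟧ ⟶ Z) :
    f ≫ ρ.app r Y ≫ g = ρ.app r X ≫ f⟦m⟧' ≫ g := by
  rw [← Category.assoc, naturality, Category.assoc]

lemma app_zero {m : ℤ} (X : T) : ρ.app (0 : 𝒜 m) X = 0 := by
  simp only [app, map_zero]
  rfl

lemma app_add {m : ℤ} (r s : 𝒜 m) (X : T) : ρ.app (r + s) X = ρ.app r X + ρ.app s X := by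
  simp only [app, map_add]
  rfl

lemma app_one (X : T) :
    ρ.app ⟨1, SetLike.GradedOne.one_mem⟩ X = (shiftFunctorZero T ℤ).inv.app X :=
  ρ.map_one X

lemma app_mul {m n : ℤ} (r : 𝒜 m) (s : 𝒜 n) (X : T) :
    ρ.app (homogeneousMul r s) X =
      ρ.app s X ≫ (ρ.app r X)⟦n⟧' ≫ (shiftFunctorAdd' T m n (m + n) rfl).inv.app X :=
  ρ.map_mul m n r s X

lemma app_comp_shift_map {m n : ℤ} (r : 𝒜 m) (s : 𝒜 n) (X : T) :
    ρ.app s X ≫ (ρ.app r X)⟦n⟧' = ρ.app r X ≫ ρ.app s (X⟦m⟧) :=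
  (ρ.naturality s (ρ.app r X)).symm

lemma comp_app_mul_eq_zero_iff {m n : ℤ} (r : 𝒜 m) (s : 𝒜 n) {A X : T} (f : A ⟶ X) :
    f ≫ ρ.app (homogeneousMul r s) X = 0 ↔
      f ≫ ρ.app r X ≫ ρ.app s (X⟦m⟧) = 0 := by
  rw [app_mul, ← app_comp_shift_map, ← Category.assoc, ← Category.assoc, ← Category.assoc,
    Preadditive.IsIso.comp_right_eq_zero]

lemma comp_app_mul_left {m n : ℤ} (r : 𝒜 m) (s : 𝒜 n) {A X : T} {f : A ⟶ X}
    (h : f ≫ ρ.app s X = 0) :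
    f ≫ ρ.app (homogeneousMul r s) X = 0 := by
  rw [app_mul, reassoc_of% h, zero_comp]

lemma comp_app_mul_right {m n : ℤ} (r : 𝒜 m) (s : 𝒜 n) {A X : T} {f : A ⟶ X}
    (h : f ≫ ρ.app r X = 0) :
    f ≫ ρ.app (homogeneousMul r s) X = 0 := by
  rw [comp_app_mul_eq_zero_iff, reassoc_of% h, zero_comp]

lemma app_shift_one {m : ℤ} (r : 𝒜 m) (X : T) :
    ρ.app r (X⟦(1 : ℤ)⟧) =
      m.negOnePow • ((ρ.app r X)⟦(1 : ℤ)⟧' ≫ (shiftFunctorComm T m 1).hom.app X) :=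
  (ρ.toFun m r).2 X

lemma shift_map_app_succ_comp {m : ℤ} (r : 𝒜 m) (X : T) (n : ℤ) :
    (ρ.app r X)⟦n + 1⟧' ≫ (shiftFunctorComm T m (n + 1)).hom.app X ≫
        ((shiftFunctorAdd T n 1).hom.app X)⟦m⟧' =
      (shiftFunctorAdd T n 1).hom.app X ≫
        ((ρ.app r X)⟦n⟧' ≫ (shiftFunctorComm T m n).hom.app X)⟦(1 : ℤ)⟧' ≫
          (shiftFunctorComm T m 1).hom.app (X⟦n⟧) := by
  rw [shiftFunctorComm_hom_app_comp_shift_shiftFunctorAdd_hom_app, Functor.map_comp,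
    Category.assoc]
  exact (shiftFunctorAdd T n 1).hom.naturality_assoc (ρ.app r X) _

lemma app_shift_succ_comp {m : ℤ} (r : 𝒜 m) (X : T) (n : ℤ) :
    ρ.app r (X⟦n + 1⟧) ≫ ((shiftFunctorAdd T n 1).hom.app X)⟦m⟧' =
      m.negOnePow • ((shiftFunctorAdd T n 1).hom.app X ≫ (ρ.app r (X⟦n⟧))⟦(1 : ℤ)⟧' ≫
          (shiftFunctorComm T m 1).hom.app (X⟦n⟧)) := by
  rw [← naturality]
  change _ ≫ ρ.app r (X⟦n⟧⟦(1 : ℤ)⟧) = _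
  rw [app_shift_one, Linear.comp_units_smul]

/-- The graded centre fixes the sign for one suspension, and the sign accumulates over `n` of them.
The inductive step is an equivalence, so it also serves negative `n`. -/
lemma app_shift {m : ℤ} (r : 𝒜 m) (X : T) (n : ℤ) :
    ρ.app r (X⟦n⟧) =
      (m * n).negOnePow • ((ρ.app r X)⟦n⟧' ≫ (shiftFunctorComm T m n).hom.app X) := by
  have hsign (n : ℤ) : (m * (n + 1)).negOnePow = m.negOnePow * (m * n).negOnePow := by
    rw [mul_add, mul_one, Int.negOnePow_add, mul_comm]
  have hstep (n : ℤ) : (ρ.app r (X⟦n + 1⟧) = (m * (n + 1)).negOnePow •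
      ((ρ.app r X)⟦n + 1⟧' ≫ (shiftFunctorComm T m (n + 1)).hom.app X)) ↔
      ρ.app r (X⟦n⟧) =
        (m * n).negOnePow • ((ρ.app r X)⟦n⟧' ≫ (shiftFunctorComm T m n).hom.app X) := by
    rw [← cancel_mono (((shiftFunctorAdd T n 1).hom.app X)⟦m⟧'), app_shift_succ_comp,
      Linear.units_smul_comp, Category.assoc, shift_map_app_succ_comp, hsign, mul_smul,
      (MulAction.injective m.negOnePow).eq_iff, ← Linear.comp_units_smul, ← Linear.units_smul_comp,
      cancel_epi, cancel_mono, ← Functor.map_units_smul]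
    exact (shiftFunctor T (1 : ℤ)).map_injective.eq_iff
  induction n using Int.induction_on with
  | zero =>
    rw [mul_zero, Int.negOnePow_zero, one_smul, shiftFunctorComm_zero_hom_app]
    have h := (shiftFunctorZero T ℤ).hom.naturality_assoc (ρ.app r X)
      (((shiftFunctorZero T ℤ).inv.app X)⟦m⟧')
    refine Eq.trans ?_ h.symm
    have h' := ρ.naturality r ((shiftFunctorZero T ℤ).inv.app X)
    refine Eq.trans ?_ (congrArg ((shiftFunctorZero T ℤ).hom.app X ≫ ·) h')
    exact ((shiftFunctorZero T ℤ).hom_inv_id_app_assoc X _).symm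
  | succ k hk => exact (hstep k).2 hk
  | pred k hk =>
    refine (hstep (-k - 1)).1 ?_
    rwa [sub_add_cancel]

lemma comp_app_shift_eq_zero {m : ℤ} (r : 𝒜 m) {A X : T} (n : ℤ) {f : A ⟶ X⟦n⟧}
    (h : f ≫ (ρ.app r X)⟦n⟧' = 0) : f ≫ ρ.app r (X⟦n⟧) = 0 := by
  rw [ρ.app_shift, Linear.comp_units_smul, reassoc_of% h, zero_comp, smul_zero]

lemma shiftedHom_comp_eq_zero_iff {m n : ℤ} (r : 𝒜 m) {C X : T} (f : ShiftedHom C X n) :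
    f.comp (gradedCentreAt T (ρ.toFun m r) X) rfl = 0 ↔ f ≫ (ρ.app r X)⟦n⟧' = 0 := by
  change f ≫ (ρ.app r X)⟦n⟧' ≫ _ = 0 ↔ _
  rw [← Category.assoc, Preadditive.IsIso.comp_right_eq_zero]

end CentralAction

lemma eq_zero_of_app_eq_zero {m : ℤ} {r : 𝒜 m} {X Y : T} [IsIso (ρ.app r Y)]
    (h : ρ.app r X = 0) (f : X ⟶ Y) : f = 0 := by
  rw [← cancel_mono (ρ.app r Y), ρ.naturality, h, zero_comp, zero_comp]

end Action

end RLinearTriangulated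

namespace RLinearTriangulated

/-! ### Annihilators of morphisms and associated primes -/

section Annihilator

variable {T : Type u} [Category.{v} T] [Preadditive T] [HasShift T ℤ]
  [∀ n : ℤ, (shiftFunctor T n).Additive] {R : Type w} [Ring R] {𝒜 : ℤ → AddSubgroup R}
  [GradedRing 𝒜] (ρ : CentralAction T 𝒜)

open DirectSum in
/-- The homogeneous ideal of the elements of `R` whose homogeneous components annihilate `f`. -/
def annihilator {A X : T} (f : A ⟶ X) : HomogeneousIdeal 𝒜 where
  carrier := {r | ∀ n, f ≫ ρ.app (decompose 𝒜 r n) X = 0}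
  zero_mem' n := by rw [decompose_zero, DirectSum.zero_apply, ρ.app_zero, comp_zero]
  add_mem' {a b} ha hb n := by
    rw [decompose_add, DirectSum.add_apply, ρ.app_add, Preadditive.comp_add, ha, hb, add_zero]
  smul_mem' r a ha := by
    induction r using DirectSum.Decomposition.inductionOn 𝒜 with
    | zero => simp [ρ.app_zero]
    | add r s hr hs =>
      intro n
      rw [add_smul, decompose_add, DirectSum.add_apply, ρ.app_add, Preadditive.comp_add, hr, hs,
        add_zero]
    | @homogeneous i r =>
      intro n
      obtain ⟨j, rfl⟩ : ∃ j, n = i + j := ⟨n - i, by ring⟩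
      have h : decompose 𝒜 ((r : R) • a) (i + j) =
          homogeneousMul r (decompose 𝒜 a j) :=
        Subtype.ext (coe_decompose_mul_add_of_left_mem 𝒜 r.2)
      rw [h]
      exact ρ.comp_app_mul_left _ _ (ha j)
  is_homogeneous' i a ha n := by
    by_cases h : i = n
    · subst h
      rw [decompose_coe, of_eq_same]
      exact ha i
    · rw [decompose_coe, of_eq_of_ne _ _ _ (Ne.symm h), ρ.app_zero, comp_zero]

open DirectSum in
lemma mem_annihilator_iff {A X : T} {f : A ⟶ X} {m : ℤ} (r : 𝒜 m) :
    (r : R) ∈ annihilator ρ f ↔ f ≫ ρ.app r X = 0 := by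
  refine ⟨fun h => ?_, fun h n => ?_⟩
  · have := h m
    rwa [decompose_coe, of_eq_same] at this
  · by_cases hn : m = n
    · subst hn
      rwa [decompose_coe, of_eq_same]
    · rw [decompose_coe, of_eq_of_ne _ _ _ (Ne.symm hn), ρ.app_zero, comp_zero]

lemma annihilator_le_annihilator_comp {A X Y : T} (f : A ⟶ X) (g : X ⟶ Y) :
    annihilator ρ f ≤ annihilator ρ (f ≫ g) := fun r hr n => by
  rw [Category.assoc, ρ.naturality, reassoc_of% hr n, zero_comp]

lemma one_notMem_annihilator {A X : T} {f : A ⟶ X} (hf : f ≠ 0) :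
    (1 : R) ∉ annihilator ρ f := by
  intro h
  have h' := (mem_annihilator_iff ρ (⟨1, SetLike.GradedOne.one_mem⟩ : 𝒜 0)).1 h
  rw [ρ.app_one, Preadditive.IsIso.comp_right_eq_zero] at h'
  exact hf h'

/-- If there are nonzero morphisms from `A` to objects of a class `Q` closed under suspensions,
then the annihilator of some of them is prime. -/
lemma exists_annihilator_eq_prime [IsNoetherianRing R] (hcomm : GradedCommutative 𝒜)
    (Q : ObjectProperty T) [Q.IsStableUnderShift ℤ] {A X : T} (hX : Q X) {f : A ⟶ X}
    (hf : f ≠ 0) :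
    ∃ (Y : T) (g : A ⟶ Y) (p : HomogeneousSpec 𝒜), Q Y ∧ g ≠ 0 ∧
      p.ideal = annihilator ρ g := by
  -- Noetherianity gives a maximal annihilator among the nonzero morphisms from `A` to objects of
  -- `Q`.
  obtain ⟨I, ⟨Y, g, hY, hg, rfl⟩, hmax⟩ := wellFounded_gt.has_min
    {I : Ideal R | ∃ (Y : T) (g : A ⟶ Y), Q Y ∧ g ≠ 0 ∧ (annihilator ρ g).toIdeal = I}
    ⟨_, X, f, hX, hf, rfl⟩
  refine ⟨Y, g, ⟨annihilator ρ g, one_notMem_annihilator ρ hg, ?_⟩, hY, hg, rfl⟩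
  intro m n r s hr hs hrs
  by_contra! h
  have hg' : g ≫ ρ.app ⟨s, hs⟩ Y ≠ 0 :=
    fun h0 => h.2 ((mem_annihilator_iff ρ ⟨s, hs⟩).2 h0)
  -- Graded commutativity exchanges `r` and `s` up to sign. So `r` kills `s` acting on `g`, a
  -- nonzero morphism whose annihilator is then strictly larger.
  have hsr : s * r ∈ annihilator ρ g := by
    rw [hcomm n m s r hs hr, Units.smul_def]
    exact (annihilator ρ g).toIdeal.smul_of_tower_mem _ hrs
  have hr' : r ∈ annihilator ρ (g ≫ ρ.app ⟨s, hs⟩ Y) := by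
    refine (mem_annihilator_iff ρ ⟨r, hr⟩).2 ?_
    rw [Category.assoc, ← ρ.comp_app_mul_eq_zero_iff]
    exact (mem_annihilator_iff ρ (homogeneousMul ⟨s, hs⟩ ⟨r, hr⟩)).1 hsr
  refine hmax _ ⟨_, g ≫ ρ.app ⟨s, hs⟩ Y, Q.le_shift n _ hY, hg', rfl⟩ ?_
  exact lt_of_le_of_ne (annihilator_le_annihilator_comp ρ g _) fun h' => h.1 (by
    have : r ∈ (annihilator ρ g).toIdeal := h' ▸ hr'
    exact this)

end Annihilator

/-! ### Torsion objects -/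

section Torsion

variable {T : Type u} [Category.{v} T] [Preadditive T] [HasShift T ℤ]
  [∀ n : ℤ, (shiftFunctor T n).Additive] [HasCoproducts.{v} T]
  {R : Type w} [Ring R] {𝒜 : ℤ → AddSubgroup R} [GradedRing 𝒜] (ρ : CentralAction T 𝒜)

lemma HomogeneousSpec.mul_notMem (p : HomogeneousSpec 𝒜) {m n : ℤ} (r : 𝒜 m) (s : 𝒜 n)
    (hr : r.1 ∉ p.ideal) (hs : s.1 ∉ p.ideal) : (homogeneousMul r s).1 ∉ p.ideal :=
  fun h => (p.mem_or_mem m n r s r.2 s.2 h).elim hr hs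

/-- Degree zero suffices because compact objects are closed under shifts. -/
lemma torsion_iff (V : Set (HomogeneousSpec 𝒜)) (X : T) : torsion ρ V X ↔
    ∀ C : T, IsCompactObj C → ∀ p ∉ V, ∀ f : C ⟶ X,
      ∃ (m : ℤ) (r : 𝒜 m), r.1 ∉ p.ideal ∧ f ≫ ρ.app r X = 0 := by
  refine ⟨fun h C hC p hp f => ?_, fun h C hC p hp n f => ?_⟩
  · obtain ⟨m, r, hr, hf⟩ := h C hC p hp 0 (f ≫ (shiftFunctorZero T ℤ).inv.app X)
    refine ⟨m, r, hr, ?_⟩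
    rw [CentralAction.act, ρ.shiftedHom_comp_eq_zero_iff, Category.assoc] at hf
    have h' := (shiftFunctorZero T ℤ).inv.naturality (ρ.app r X)
    rw [← h', ← Category.assoc, Preadditive.IsIso.comp_right_eq_zero] at hf
    exact hf
  · obtain ⟨g, rfl⟩ := exists_eq_comp_shift_map f
    obtain ⟨m, r, hr, hg⟩ := h _ (hC.shift (-n)) p hp g
    refine ⟨m, r, hr, ?_⟩
    rw [CentralAction.act, ρ.shiftedHom_comp_eq_zero_iff, Category.assoc,
      ← Functor.map_comp, hg, Functor.map_zero, comp_zero]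

lemma torsion_mono {V V' : Set (HomogeneousSpec 𝒜)} (h : V ⊆ V') : torsion ρ V ≤ torsion ρ V' :=
  fun _ hX C hC p hp => hX C hC p fun hpV => hp (h hpV)

/-- Being `{p}ᶜ`-torsion means that the localisation at the single prime `p` vanishes, so torsion
can be checked one prime at a time. The set `{p}ᶜ` need not be specialisation closed. -/
lemma torsion_of_forall {V : Set (HomogeneousSpec 𝒜)} {X : T}
    (h : ∀ p ∉ V, torsion ρ {p}ᶜ X) : torsion ρ V X :=
  fun C hC p hp => h p hp C hC p fun hpp => hpp rfl

variable [HasZeroObject T] [Pretriangulated T]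

-- Homogeneous elements outside a prime are closed under products, so annihilating elements for the
-- ends of a triangle multiply to one for the middle; compactness reduces a coproduct to finitely
-- many summands.
open ZeroObject in
lemma isLocalising_torsion (V : Set (HomogeneousSpec 𝒜)) : IsLocalising (torsion ρ V) := by
  classical
  have hiso : (torsion ρ V).IsClosedUnderIsomorphisms := ⟨fun {X Y} e hX => by
    rw [torsion_iff] at hX ⊢
    intro C hC p hp f
    obtain ⟨m, r, hr, hf⟩ := hX C hC p hp (f ≫ e.inv)
    refine ⟨m, r, hr, ?_⟩
    rw [← Category.comp_id f, ← e.inv_hom_id, Category.assoc, Category.assoc, ρ.naturality,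
      ← Category.assoc, ← Category.assoc, hf, zero_comp]⟩
  have h₀ : (torsion ρ V).ContainsZero := ⟨0, isZero_zero T, by
    rw [torsion_iff]
    intro C hC p hp f
    exact ⟨0, ⟨1, SetLike.GradedOne.one_mem⟩, p.one_notMem, by
      rw [(isZero_zero T).eq_of_tgt f 0, zero_comp]⟩⟩
  have h₁ : (torsion ρ V).IsStableUnderShift ℤ := ⟨fun n => ⟨fun X hX => by
    change torsion ρ V (X⟦n⟧)
    rw [torsion_iff] at hX ⊢
    intro C hC p hp f
    obtain ⟨g, rfl⟩ := exists_eq_comp_shift_map f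
    obtain ⟨m, r, hr, hg⟩ := hX _ (hC.shift (-n)) p hp g
    refine ⟨m, r, hr, ρ.comp_app_shift_eq_zero r n ?_⟩
    rw [Category.assoc, ← Functor.map_comp, hg, Functor.map_zero, comp_zero]⟩⟩
  have h₂ : (torsion ρ V).IsTriangulatedClosed₂ := .mk' fun ⟨X₁, X₂, X₃, a, b, c⟩ ht hX₁ hX₃ => by
    change torsion ρ V X₂
    have hX₁' : torsion ρ V X₁ := hX₁
    have hX₃' : torsion ρ V X₃ := hX₃
    have hX₁s (m : ℤ) : torsion ρ V (X₁⟦m⟧) := (torsion ρ V).le_shift m _ hX₁'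
    rw [torsion_iff] at hX₃' ⊢
    simp only [torsion_iff] at hX₁s
    intro C hC p hp f
    obtain ⟨m, r, hr, hf⟩ := hX₃' C hC p hp (f ≫ b)
    rw [Category.assoc, ρ.naturality, ← Category.assoc] at hf
    -- Desuspending by `m` allows the given triangle to be used instead of its `m`-fold shift.
    obtain ⟨g, hg⟩ : ∃ g : C ⟶ X₁⟦m⟧, f ≫ ρ.app r X₂ = g ≫ a⟦m⟧' := by
      obtain ⟨k, hk⟩ := exists_eq_comp_shift_map (f ≫ ρ.app r X₂)
      rw [hk, Category.assoc, Preadditive.IsIso.comp_left_eq_zero, ← Functor.map_comp] at hf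
      obtain ⟨l, hl⟩ := exists_of_comp_mor₂_eq_zero ht k ((shiftFunctor T m).map_eq_zero_iff.1 hf)
      exact ⟨(shiftNegShift C m).inv ≫ l⟦m⟧', by rw [hk, hl, Functor.map_comp, Category.assoc]⟩
    obtain ⟨n, s, hs, hgs⟩ := hX₁s m C hC p hp g
    refine ⟨_, _, p.mul_notMem r s hr hs, ?_⟩
    rw [ρ.comp_app_mul_eq_zero_iff, reassoc_of% hg, ρ.naturality, reassoc_of% hgs, zero_comp]
  refine ⟨{}, hiso, fun J => isClosedUnderColimitsOfShape_discrete fun Y hY => ?_⟩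
  simp only [torsion_iff] at hY ⊢
  intro C hC p hp f
  obtain ⟨s, g, rfl⟩ := hC.exists_eq_sum f
  induction s using Finset.induction_on with
  | empty => exact ⟨0, ⟨1, SetLike.GradedOne.one_mem⟩, p.one_notMem, by simp⟩
  | insert j s hj ih =>
    obtain ⟨m, r, hr, h⟩ := ih
    obtain ⟨m', r', hr', h'⟩ := hY j C hC p hp (g j)
    refine ⟨_, _, p.mul_notMem r r' hr hr', ?_⟩
    rw [Finset.sum_insert hj, Preadditive.add_comp, ρ.comp_app_mul_right r r' h, add_zero]
    refine ρ.comp_app_mul_left r r' ?_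
    rw [Category.assoc, ρ.naturality, reassoc_of% h', zero_comp]

instance (V : Set (HomogeneousSpec 𝒜)) : (torsion ρ V).IsStableUnderShift ℤ :=
  (isLocalising_torsion ρ V).isTriangulated.toIsStableUnderShift

end Torsion

end RLinearTriangulated

namespace RLinearTriangulated

/-! ### Koszul objects -/

section Koszul

variable {T : Type u} [Category.{v} T] [Preadditive T] [HasShift T ℤ] [HasZeroObject T]
  [∀ n : ℤ, (shiftFunctor T n).Additive] [Pretriangulated T]
  {R : Type w} [Ring R] {𝒜 : ℤ → AddSubgroup R} [GradedRing 𝒜] (ρ : CentralAction T 𝒜)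

/-- The square of `r` annihilates each cone of the action of `r`. -/
lemma app_mul_self_cone_eq_zero {m : ℤ} (r : 𝒜 m) {X Z : T} {b : X⟦m⟧ ⟶ Z}
    {c : Z ⟶ X⟦(1 : ℤ)⟧} (ht : Triangle.mk (ρ.app r X) b c ∈ distTriang T) :
    ρ.app (homogeneousMul r r) Z = 0 := by
  have hb : ρ.app r X ≫ b = 0 := comp_distTriang_mor_zero₁₂ _ ht
  have hc : c ≫ (ρ.app r X)⟦(1 : ℤ)⟧' = 0 := comp_distTriang_mor_zero₃₁ _ ht
  have hbr : b ≫ ρ.app r Z = 0 := by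
    rw [ρ.naturality, ρ.app_shift, shiftFunctorComm_eq_refl, Linear.units_smul_comp,
      Iso.refl_hom, NatTrans.id_app, Category.assoc]
    have h : (ρ.app r X)⟦m⟧' ≫ 𝟙 _ ≫ b⟦m⟧' = 0 := by
      rw [Category.id_comp, ← Functor.map_comp, hb, Functor.map_zero]
    exact (congrArg _ h).trans (smul_zero _)
  have hcr : ρ.app r Z ≫ c⟦m⟧' = 0 := by
    rw [← ρ.naturality]
    exact ρ.comp_app_shift_eq_zero r 1 hc
  -- Since `r` kills `b`, its action on the cone factors through `c`; since `r` also kills `c`,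
  -- acting twice gives zero.
  obtain ⟨w, hw⟩ := exists_of_mor₂_comp_eq_zero ht _ hbr
  have h : ρ.app r Z ≫ (ρ.app r Z)⟦m⟧' = 0 := by
    conv_lhs => rw [hw, Functor.map_comp, ← hw, reassoc_of% hcr, zero_comp]
  rw [ρ.app_mul, reassoc_of% h, zero_comp]

/-- By naturality, a morphism killed by `r` has its `m`-th shift factoring through the cone of `r`.
This is how cones detect torsion. -/
lemma eq_zero_of_comp_app_eq_zero {m : ℤ} (r : 𝒜 m) {X Z : T} {b : X⟦m⟧ ⟶ Z}
    {c : Z ⟶ X⟦(1 : ℤ)⟧} (ht : Triangle.mk (ρ.app r X) b c ∈ distTriang T) {Y : T}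
    (hY : ∀ f : Z ⟶ Y⟦m⟧, f = 0) {f : X ⟶ Y} (hf : f ≫ ρ.app r Y = 0) : f = 0 := by
  rw [ρ.naturality] at hf
  obtain ⟨l, hl⟩ := exists_of_mor₁_comp_eq_zero ht _ hf
  rw [hY l, comp_zero] at hl
  exact (shiftFunctor T m).map_eq_zero_iff.1 hl

variable [HasCoproducts.{v} T]

lemma torsion_cone {p : HomogeneousSpec 𝒜} {m : ℤ} {r : 𝒜 m} (hr : r.1 ∉ p.ideal) {X Z : T}
    {b : X⟦m⟧ ⟶ Z} {c : Z ⟶ X⟦(1 : ℤ)⟧}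
    (ht : Triangle.mk (ρ.app r X) b c ∈ distTriang T) : torsion ρ {p}ᶜ Z := by
  rw [torsion_iff]
  intro C _ q hq f
  obtain rfl : q = p := by simpa using hq
  exact ⟨_, homogeneousMul r r, q.mul_notMem r r hr hr, by
    rw [app_mul_self_cone_eq_zero ρ r ht, comp_zero]⟩

/-- Koszul objects: for a finite list `l` of homogeneous elements and a compact object `G` there
is a compact object that is torsion for the primes containing `l` and that detects the vanishing
of the morphisms from `G` to such torsion objects. -/
lemma exists_koszul [IsNoetherianRing R] (hcomm : GradedCommutative 𝒜)
    (l : List (Σ m : ℤ, 𝒜 m)) {G : T} (hG : IsCompactObj G) :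
    ∃ K : T, IsCompactObj K ∧ (∀ p : HomogeneousSpec 𝒜, (∃ x ∈ l, x.2.1 ∉ p.ideal) →
        torsion ρ {p}ᶜ K) ∧
      ∀ V : Set (HomogeneousSpec 𝒜), (∀ p ∈ V, ∀ x ∈ l, x.2.1 ∈ p.ideal) →
        ∀ Y : T, torsion ρ V Y → gradedOrthogonal (fun _ : Unit => K) Y →
          gradedOrthogonal (fun _ : Unit => G) Y := by
  induction l with
  | nil => exact ⟨G, hG, by simp, fun V _ Y _ hY => hY⟩
  | cons x l ih =>
    obtain ⟨K, hK, hKtors, hKorth⟩ := ih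
    obtain ⟨m, r⟩ := x
    obtain ⟨Z, b, c, ht⟩ := distinguished_cocone_triangle (ρ.app r K)
    refine ⟨Z, hK.cone ht (hK.shift m), fun p hp => ?_, fun V hV Y hY hZ => ?_⟩
    · obtain ⟨x, hx, hxp⟩ := hp
      rcases List.mem_cons.1 hx with rfl | hx
      · exact torsion_cone ρ hxp ht
      · have h := hKtors p ⟨x, hx, hxp⟩
        have hloc := isLocalising_torsion ρ ({p}ᶜ : Set (HomogeneousSpec 𝒜))
        exact hloc.ext₃ ht h (hloc.prop_shift h m)
    · refine hKorth V (fun p hp x hx => hV p hp x (List.mem_cons_of_mem _ hx)) Y hY ?_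
      let Q : ObjectProperty T := torsion ρ V ⊓ gradedOrthogonal (fun _ : Unit => Z)
      have hQ : Q.IsStableUnderShift ℤ :=
        ⟨fun n => ⟨fun X hX => ⟨(isLocalising_torsion ρ V).prop_shift hX.1 n, hX.2.shift n⟩⟩⟩
      have hzero (X : T) (hX : Q X) (f : K ⟶ X) : f = 0 := by
        -- A nonzero morphism yields one, `g`, with prime annihilator `p`. Torsion forces `p ∈ V`,
        -- so `r ∈ p` kills `g`; but `r` acts injectively because the cone `Z` has no morphisms to
        -- shifts of `X'`.
        by_contra hf
        obtain ⟨X', g, p, hX', hg, hp⟩ := exists_annihilator_eq_prime ρ hcomm Q hX hf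
        have hpV : p ∈ V := by
          by_contra hpV
          obtain ⟨n, s, hs, hgs⟩ := (torsion_iff ρ V X').1 hX'.1 K hK p hpV g
          exact hs (hp ▸ (mem_annihilator_iff ρ s).2 hgs)
        have hr : r.1 ∈ annihilator ρ g := hp ▸ hV p hpV ⟨m, r⟩ List.mem_cons_self
        exact hg (eq_zero_of_comp_app_eq_zero ρ r ht
          (fun k => (hX'.2.shift m).eq_zero' (j := ()) k) ((mem_annihilator_iff ρ r).1 hr))
      intro _ n f
      have h := hzero _ (Q.le_shift (-n) _ ⟨hY, hZ⟩) ((shiftShiftNeg K n).inv ≫ f⟦-n⟧')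
      rw [Preadditive.IsIso.comp_left_eq_zero] at h
      exact (shiftFunctor T (-n)).map_eq_zero_iff.1 h

end Koszul

/-! ### Compact generators of torsion objects -/

section Orthogonal

variable {T : Type u} [Category.{v} T] [Preadditive T] [HasShift T ℤ] [HasZeroObject T]
  [∀ n : ℤ, (shiftFunctor T n).Additive] [Pretriangulated T] [HasCoproducts.{v} T]

/-- The left orthogonal of the graded orthogonal of `G` is localising and contains `G`, so it is all
of `T` and the identity of `X` vanishes. -/
lemma isZero_of_gradedOrthogonal {ι : Type*} {G : ι → T}
    (hG : loc (ObjectProperty.ofObj G) = ⊤) {X : T} (hX : gradedOrthogonal G X) : IsZero X := by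
  have hs : (gradedOrthogonal G).IsStableUnderShift ℤ := ⟨fun n => ⟨fun X hX => hX.shift n⟩⟩
  have hloc : IsLocalising (gradedOrthogonal G).leftOrthogonal :=
    ⟨inferInstance, inferInstance, fun J => isClosedUnderColimitsOfShape_discrete
      fun Y hY Z f hZ => Sigma.hom_ext _ _ fun j => by rw [hY j (Sigma.ι Y j ≫ f) hZ, comp_zero]⟩
  have hle : ObjectProperty.ofObj G ≤ (gradedOrthogonal G).leftOrthogonal := by
    rintro _ ⟨i⟩ Y f hY
    exact hY.eq_zero' f
  have hX' : loc (ObjectProperty.ofObj G) X := by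
    rw [hG]
    trivial
  rw [IsZero.iff_id_eq_zero]
  exact loc_le hloc hle X hX' (𝟙 X) hX

variable {R : Type w} [Ring R] {𝒜 : ℤ → AddSubgroup R} [GradedRing 𝒜] (ρ : CentralAction T 𝒜)

/-- If the torsion objects have a set of compact generators, then their right orthogonal is the
graded orthogonal of these generators, and it is a localising subcategory. -/
lemma isLocalising_of_generators {V : Set (HomogeneousSpec 𝒜)} {J : Type v} {G : J → T}
    (hG : ∀ j, IsCompactObj (G j)) (hGV : ∀ j, torsion ρ V (G j))
    (h₀ : ∀ X, torsion ρ V X → gradedOrthogonal G X → IsZero X) :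
    IsLocalising (torsion ρ V).rightOrthogonal := by
  have hloc := isLocalising_torsion ρ V
  refine isLocalising_rightOrthogonal _ fun I Y hY => ?_
  refine rightOrthogonal_of_gradedOrthogonal hloc hGV hG h₀ (gradedOrthogonal_sigma hG Y ?_)
  exact fun i j n f => hY i f (hloc.prop_shift (hGV j) n)

/-- Finitely many homogeneous generators of `p` make `𝒱(𝔭)` the zero locus of a list, as
`exists_koszul` requires. -/
lemma exists_homogeneous_list [IsNoetherianRing R] (p : HomogeneousSpec 𝒜) :
    ∃ l : List (Σ m : ℤ, 𝒜 m), (∀ x ∈ l, x.2.1 ∈ p.ideal) ∧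
      ∀ q : HomogeneousSpec 𝒜, (∀ x ∈ l, x.2.1 ∈ q.ideal) → p.ideal ≤ q.ideal := by
  classical
  let s : Set R := {r | SetLike.IsHomogeneousElem 𝒜 r ∧ r ∈ p.ideal}
  obtain ⟨t, hts, ht⟩ := (Submodule.fg_span_iff_fg_span_finset_subset (R := R) s).1
    (IsNoetherian.noetherian _)
  have hmem (r : t) : ∃ m, r.1 ∈ 𝒜 m := (hts r.2).1
  choose d hd using hmem
  refine ⟨t.attach.toList.map fun r => ⟨d r, ⟨r.1, hd r⟩⟩, ?_, fun q hq r hr => ?_⟩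
  · intro x hx
    obtain ⟨r, -, rfl⟩ := List.mem_map.1 hx
    exact (hts r.2).2
  · have htq : Submodule.span R (t : Set R) ≤ q.ideal.toIdeal := by
      rw [Submodule.span_le]
      intro a ha
      exact hq _ (List.mem_map.2 ⟨⟨a, ha⟩, by simp, rfl⟩)
    refine htq ?_
    rw [← ht, ← DirectSum.sum_support_decompose 𝒜 r]
    exact Submodule.sum_mem _ fun i _ =>
      Submodule.subset_span ⟨⟨i, SetLike.coe_mem _⟩, p.ideal.isHomogeneous i hr⟩

lemma isLocalising_rightOrthogonal_primesAbove (hT : CompactlyGenerated T) [IsNoetherianRing R]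
    (hcomm : GradedCommutative 𝒜) (p : HomogeneousSpec 𝒜) :
    IsLocalising (torsion ρ (primesAbove p)).rightOrthogonal := by
  obtain ⟨ι, G, hG, hGtop⟩ := hT
  obtain ⟨l, hl, hl'⟩ := exists_homogeneous_list p
  choose K hK hKtors hKorth using fun i => exists_koszul ρ hcomm l (hG i)
  refine isLocalising_of_generators ρ hK (fun i => torsion_of_forall ρ fun q hq => ?_)
    fun X hX hX' => isZero_of_gradedOrthogonal hGtop fun i n f => ?_
  · refine hKtors i q ?_
    by_contra! h
    exact hq (hl' q h)
  · exact hKorth i _ (fun q (hq : p.ideal ≤ q.ideal) x hx => hq (hl x hx)) X hX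
      (fun _ => hX' i) () n f

/-! ### Local objects, the subcategories `Γ_𝔭 T` and the classification -/

lemma mem_primesNotBelow_compl {p q : HomogeneousSpec 𝒜} (hq : q ∉ primesNotBelow p) :
    q.ideal ≤ p.ideal :=
  not_not.1 hq

lemma torsion_primesNotBelow_cone {p : HomogeneousSpec 𝒜} {m : ℤ} {r : 𝒜 m}
    (hr : r.1 ∉ p.ideal) {X Z : T} {b : X⟦m⟧ ⟶ Z} {c : Z ⟶ X⟦(1 : ℤ)⟧}
    (ht : Triangle.mk (ρ.app r X) b c ∈ distTriang T) : torsion ρ (primesNotBelow p) Z :=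
  torsion_of_forall ρ fun _ hq =>
    torsion_cone ρ (fun h => hr (mem_primesNotBelow_compl hq h)) ht

/-- The cone of `r` on `Y` is both `𝔭`-local and `𝒵(𝔭)`-torsion, hence zero. -/
lemma isIso_app_of_rightOrthogonal {p : HomogeneousSpec 𝒜} {Y : T}
    (hY : (torsion ρ (primesNotBelow p)).rightOrthogonal Y) {m : ℤ} {r : 𝒜 m}
    (hr : r.1 ∉ p.ideal) : IsIso (ρ.app r Y) := by
  obtain ⟨Z, b, c, ht⟩ := distinguished_cocone_triangle (ρ.app r Y)
  refine isIso₁_of_isZero₃ ht ?_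
  have hZ : (torsion ρ (primesNotBelow p)).rightOrthogonal Z :=
    ObjectProperty.ext_of_isTriangulatedClosed₃ _ _ ht hY (ObjectProperty.le_shift _ m _ hY)
  rw [IsZero.iff_id_eq_zero]
  exact hZ _ (torsion_primesNotBelow_cone ρ hr ht)

/-- There are enough compact objects among the torsion objects for `primesNotBelow p`, namely the
cones of the actions of homogeneous elements outside `p` on compact generators of `T`. -/
lemma exists_generators_primesNotBelow (hT : CompactlyGenerated T) (p : HomogeneousSpec 𝒜) :
    ∃ (J : Type v) (Z : J → T), (∀ j, IsCompactObj (Z j)) ∧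
      (∀ j, torsion ρ (primesNotBelow p) (Z j)) ∧
      (∀ X, torsion ρ (primesNotBelow p) X → gradedOrthogonal Z X → IsZero X) ∧
      ∀ j, ∃ (m : ℤ) (r : 𝒜 m), r.1 ∉ p.ideal ∧ ρ.app r (Z j) = 0 := by
  obtain ⟨ι, G, hG, hGtop⟩ := hT
  -- Indexing by the induced morphisms, not by the elements of `R`, keeps `J` in `Type v`.
  let J : Type v := Σ (i : ι) (m : ℤ),
    {e : G i ⟶ (G i)⟦m⟧ // ∃ r : 𝒜 m, r.1 ∉ p.ideal ∧ ρ.app r (G i) = e}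
  have hcone (j : J) : ∃ (Z : T) (b : (G j.1)⟦j.2.1⟧ ⟶ Z) (c : Z ⟶ (G j.1)⟦(1 : ℤ)⟧),
      Triangle.mk j.2.2.1 b c ∈ distTriang T := distinguished_cocone_triangle _
  choose Z b c ht using hcone
  refine ⟨J, Z, fun j => (hG j.1).cone (ht j) ((hG j.1).shift _), ?_, ?_, ?_⟩
  · rintro ⟨i, m, e, r, hr, rfl⟩
    exact torsion_primesNotBelow_cone ρ hr (ht ⟨i, m, ρ.app r (G i), r, hr, rfl⟩)
  · refine fun X hX hX' => isZero_of_gradedOrthogonal hGtop fun i n f => ?_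
    have hX'' := (torsion_iff ρ _ _).1 ((isLocalising_torsion ρ _).prop_shift hX (-n))
    obtain ⟨m, r, hr, h⟩ := hX'' _ (hG i) p (fun h => h le_rfl)
      ((shiftShiftNeg (G i) n).inv ≫ f⟦-n⟧')
    have h0 := eq_zero_of_comp_app_eq_zero ρ r (ht ⟨i, m, ρ.app r (G i), r, hr, rfl⟩)
      (fun g => ((hX'.shift (-n)).shift m).eq_zero' g) h
    rw [Preadditive.IsIso.comp_left_eq_zero] at h0
    exact (shiftFunctor T (-n)).map_eq_zero_iff.1 h0
  · rintro ⟨i, m, e, r, hr, rfl⟩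
    exact ⟨_, homogeneousMul r r, p.mul_notMem r r hr hr,
      app_mul_self_cone_eq_zero ρ r (ht ⟨i, m, ρ.app r (G i), r, hr, rfl⟩)⟩

lemma isLocalising_rightOrthogonal_primesNotBelow (hT : CompactlyGenerated T)
    (p : HomogeneousSpec 𝒜) : IsLocalising (torsion ρ (primesNotBelow p)).rightOrthogonal := by
  obtain ⟨J, Z, hZ, hZtors, hZ₀, -⟩ := exists_generators_primesNotBelow ρ hT p
  exact isLocalising_of_generators ρ hZ hZtors hZ₀

/-- An object is `p`-local as soon as the homogeneous elements outside `p` act invertibly. -/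
lemma rightOrthogonal_of_isIso_app (hT : CompactlyGenerated T) {p : HomogeneousSpec 𝒜} {Y : T}
    (hY : ∀ (m : ℤ) (r : 𝒜 m), r.1 ∉ p.ideal → IsIso (ρ.app r Y)) :
    (torsion ρ (primesNotBelow p)).rightOrthogonal Y := by
  obtain ⟨J, Z, hZ, hZtors, hZ₀, hZr⟩ := exists_generators_primesNotBelow ρ hT p
  refine rightOrthogonal_of_gradedOrthogonal (isLocalising_torsion ρ _) hZtors hZ hZ₀ ?_
  intro j n f
  -- Some `r` outside `p` is zero on the generator `Z j` but invertible on `Y`, which leaves no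
  -- nonzero morphisms between their shifts.
  obtain ⟨m, r, hr, h⟩ := hZr j
  have := hY m r hr
  refine eq_zero_of_app_eq_zero ρ (r := r) ?_ f
  rw [← Category.id_comp (ρ.app r _)]
  refine ρ.comp_app_shift_eq_zero r n ?_
  rw [h, Functor.map_zero, comp_zero]

/-- A colocalisation of an object on which `r` acts invertibly is such an object. -/
lemma isIso_app_of_isColocalisationOf {V : Set (HomogeneousSpec 𝒜)} {X Y : T}
    (h : IsColocalisationOf ρ V X Y) {m : ℤ} (r : 𝒜 m) [IsIso (ρ.app r X)] :
    IsIso (ρ.app r Y) := by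
  obtain ⟨L, hY, hL, a, b, c, ht⟩ := h
  have hloc := isLocalising_torsion ρ V
  have hinj {A : T} (hA : torsion ρ V A) (k : A ⟶ Y) (hk : k ≫ a = 0) : k = 0 := by
    obtain ⟨l, hl⟩ := exists_of_comp_mor₁_eq_zero ht (k⟦(1 : ℤ)⟧')
      (by rw [← Functor.map_comp, hk, Functor.map_zero])
    rw [hL l (hloc.prop_shift hA 1), zero_comp] at hl
    exact (shiftFunctor T (1 : ℤ)).map_eq_zero_iff.1 hl
  have hinj' {A : T} (hA : torsion ρ V A) (k : A ⟶ Y⟦m⟧) (hk : k ≫ a⟦m⟧' = 0) : k = 0 := by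
    obtain ⟨l, rfl⟩ := exists_eq_comp_shift_map k
    rw [Category.assoc, Preadditive.IsIso.comp_left_eq_zero, ← Functor.map_comp] at hk
    rw [hinj (hloc.prop_shift hA (-m)) l ((shiftFunctor T m).map_eq_zero_iff.1 hk),
      Functor.map_zero, comp_zero]
  have hYm := hloc.prop_shift hY m
  -- Torsion objects have no morphisms to `L`, so the inverse of `r` on `X`, restricted to `Y⟦m⟧`,
  -- lifts to `Y`; `hinj` and `hinj'` show that the lift is a two-sided inverse.
  obtain ⟨s, hs⟩ := exists_of_comp_mor₂_eq_zero ht (a⟦m⟧' ≫ inv (ρ.app r X)) (hL _ hYm)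
  refine ⟨s, ?_, ?_⟩
  · rw [← sub_eq_zero]
    refine hinj hY _ ?_
    rw [Preadditive.sub_comp, Category.assoc, ← hs, ← ρ.naturality_assoc, IsIso.hom_inv_id,
      Category.comp_id, Category.id_comp, sub_self]
  · rw [← sub_eq_zero]
    refine hinj' hYm _ ?_
    rw [Preadditive.sub_comp, Category.assoc, ← ρ.naturality, ← Category.assoc, ← hs,
      Category.assoc, IsIso.inv_hom_id, Category.comp_id, Category.id_comp, sub_self]

lemma isColocalisationOf_of_torsion {V : Set (HomogeneousSpec 𝒜)} {X : T}
    (hX : torsion ρ V X) : IsColocalisationOf ρ V X X :=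
  ⟨_, hX, fun _ _ _ => (isZero_zero T).eq_of_tgt _ _, _, _, _,
    contractible_distinguished X⟩

lemma isLocalisationOf_of_rightOrthogonal {V : Set (HomogeneousSpec 𝒜)} {X : T}
    (hX : (torsion ρ V).rightOrthogonal X) : IsLocalisationOf ρ V X X :=
  ⟨_, (isLocalising_torsion ρ V).prop_of_isZero (isZero_zero T), hX, _, _, _,
    contractible_distinguished₁ X⟩

/-- The objects of `Γ_𝔭 T` are the `𝔭`-local and `𝒱(𝔭)`-torsion objects. -/
lemma gammaImage_eq (hT : CompactlyGenerated T) (p : HomogeneousSpec 𝒜) :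
    gammaImage ρ p = torsion ρ (primesAbove p) ⊓
      (torsion ρ (primesNotBelow p)).rightOrthogonal := by
  refine le_antisymm ?_ fun Y hY => ⟨Y, Y, isLocalisationOf_of_rightOrthogonal ρ hY.2,
    isColocalisationOf_of_torsion ρ hY.1⟩
  rintro Y ⟨X, Xp, ⟨G, -, hXp, -⟩, hY⟩
  -- `𝔭`-locality is invertibility of the elements outside `𝔭`, and in this form it passes from `Xp`
  -- to its colocalisation.
  refine ⟨hY.choose_spec.1, rightOrthogonal_of_isIso_app ρ hT fun m r hr => ?_⟩
  have := isIso_app_of_rightOrthogonal ρ hXp hr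
  exact isIso_app_of_isColocalisationOf ρ hY r

lemma isLocalising_gammaImage (hT : CompactlyGenerated T) (p : HomogeneousSpec 𝒜) :
    IsLocalising (gammaImage ρ p) := by
  rw [gammaImage_eq ρ hT]
  exact (isLocalising_torsion ρ _).inf (isLocalising_rightOrthogonal_primesNotBelow ρ hT p)

/-- Objects of `Γ_𝔭 T` that are built from objects of `Γ_𝔮 T` with varying `𝔮` are built from
those with `𝔮 = 𝔭` only. -/
lemma loc_inf_gammaImage_le [IsTriangulated T] (hT : CompactlyGenerated T) [IsNoetherianRing R]
    (hcomm : GradedCommutative 𝒜) {P : ObjectProperty T} {p : HomogeneousSpec 𝒜}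
    {S : ObjectProperty T} (hS : IsLocalising S) (hSp : S ≤ gammaImage ρ p)
    (hP : ∀ X, P X → S X ∨ ∃ q ≠ p, gammaImage ρ q X) :
    loc P ⊓ gammaImage ρ p ≤ S := by
  rw [gammaImage_eq ρ hT] at hSp ⊢
  let A := torsion ρ (primesNotBelow p)
  let C := (torsion ρ (primesAbove p)).rightOrthogonal ⊓ A.rightOrthogonal
  have hA : IsLocalising A := isLocalising_torsion ρ _
  have hC : IsLocalising C := (isLocalising_rightOrthogonal_primesAbove ρ hT hcomm p).inf
    (isLocalising_rightOrthogonal_primesNotBelow ρ hT p)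
  have hAorth := isLocalising_rightOrthogonal_primesNotBelow ρ hT p
  have hSC : C ≤ S.rightOrthogonal := fun Y hY X f hX => hY.1 f (hSp X hX).1
  have hB := isLocalising_extensionProduct hS hC hSC
  have hAB : ObjectProperty.extensionProduct S C ≤ A.rightOrthogonal := by
    rintro X ⟨_, _, _, _, _, ht, hY, hZ⟩
    exact hAorth.ext₂ ht (hSp _ hY).2 hZ.2
  have hE := isLocalising_extensionProduct hA hB hAB
  have := hA.isTriangulated
  have := hS.isTriangulated
  have := hC.isTriangulated
  have := hB.isTriangulated
  -- The position of `𝔮` relative to `𝔭` decides which of the three layers contains `Γ_𝔮 T`.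
  have hPE : P ≤ ObjectProperty.extensionProduct A (ObjectProperty.extensionProduct S C) := by
    intro X hX
    rcases hP X hX with hX | ⟨q, hqp, hX⟩
    · exact ObjectProperty.le_extensionProduct_right _ _
        (ObjectProperty.le_extensionProduct_left _ _ hX)
    · rw [gammaImage_eq ρ hT] at hX
      by_cases hle : q.ideal ≤ p.ideal
      · refine ObjectProperty.le_extensionProduct_right _ _
          (ObjectProperty.le_extensionProduct_right _ _ ⟨?_, ?_⟩)
        -- Here `𝒱(𝔭) ⊆ 𝒵(𝔮)`: a prime containing `𝔭` and contained in `𝔮` would force `𝔮 = 𝔭`.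
        · refine rightOrthogonal_antitone (torsion_mono ρ ?_) X hX.2
          intro q' hq' hle'
          apply hqp
          have h : q.ideal = p.ideal := le_antisymm hle (hq'.trans hle')
          cases q
          cases p
          simpa using h
        · refine rightOrthogonal_antitone (torsion_mono ρ ?_) X hX.2
          exact fun q' hq' hle' => hq' (hle'.trans hle)
      · refine ObjectProperty.le_extensionProduct_left _ _ (torsion_mono ρ ?_ X hX.1)
        exact fun q' hq' hle' => hle (hq'.trans hle')
  rintro X ⟨hX, hXtors, hXorth⟩
  have hXB := prop_right_of_extensionProduct hA hB hAB hXorth (loc_le hE hPE X hX)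
  exact prop_left_of_extensionProduct hS (isLocalising_torsion ρ (primesAbove p))
    (fun Y hY => (hSp Y hY).1) (fun Y hY => hY.1) hXtors hXB

/-- The local-global principle recovers a localising subcategory from its local pieces. -/
lemma loc_iSup_inf_gammaImage (hlg : LocalGlobalPrinciple ρ) {S : ObjectProperty T}
    (hS : IsLocalising S) : loc (⨆ p : supp ρ, S ⊓ gammaImage ρ p.1) = S := by
  refine le_antisymm (loc_le hS (iSup_le fun _ => inf_le_left)) fun X hX => ?_
  have hle : loc (ObjectProperty.singleton X) ≤ S :=
    loc_le hS (by
      rintro _ ⟨⟩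
      exact hX)
  have hX' : loc (ObjectProperty.singleton X) X := le_loc _ _ (by simp)
  rw [hlg X] at hle hX'
  refine loc_le (isLocalising_loc _) ?_ X hX'
  rintro Y ⟨p, hY⟩
  -- Only a nonzero `Γ_𝔭 X` puts `𝔭` into the support; zero objects lie in every localising
  -- subcategory.
  by_cases hY0 : IsZero Y
  · exact (isLocalising_loc _).prop_of_isZero hY0
  · refine le_loc _ _ (le_iSup (fun p : supp ρ => S ⊓ gammaImage ρ p.1) ⟨p, Y, ⟨X, hY⟩, hY0⟩ Y
      ⟨hle Y (le_loc _ _ ⟨p, hY⟩), X, hY⟩)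

lemma loc_iSup_inf_gammaImage_eq [IsTriangulated T] (hT : CompactlyGenerated T)
    [IsNoetherianRing R] (hcomm : GradedCommutative 𝒜)
    (F : (p : supp ρ) → LocalisingSubcategoryOf (gammaImage ρ p.1)) (p : supp ρ) :
    loc (⨆ q, (F q).1) ⊓ gammaImage ρ p.1 = (F p).1 := by
  refine le_antisymm ?_ (le_inf ((le_iSup (fun q => (F q).1) p).trans (le_loc _)) (F p).2.2)
  refine loc_inf_gammaImage_le ρ hT hcomm (F p).2.1 (F p).2.2 fun X hX => ?_
  obtain ⟨q, hq⟩ : ∃ q, (F q).1 X := by simpa using hX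
  by_cases h : q = p
  · subst h
    exact Or.inl hq
  · exact Or.inr ⟨q.1, fun h' => h (Subtype.ext h'), (F q).2.2 X hq⟩

end Orthogonal

end RLinearTriangulated

theorem mainTheorem8
    {T : Type u} [Category.{v} T] [Preadditive T] [HasZeroObject T] [HasShift T ℤ]
    [∀ n : ℤ, (shiftFunctor T n).Additive] [Pretriangulated T] [IsTriangulated T]
    [HasCoproducts.{v} T]
    (hT : RLinearTriangulated.CompactlyGenerated T)
    {R : Type w} [Ring R] (𝒜 : ℤ → AddSubgroup R) [GradedRing 𝒜]
    (hcomm : RLinearTriangulated.GradedCommutative 𝒜) [IsNoetherianRing R]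
    (ρ : RLinearTriangulated.CentralAction T 𝒜)
    (hlg : RLinearTriangulated.LocalGlobalPrinciple ρ) :
    ∃ σ : RLinearTriangulated.LocalisingSubcategory T ≃o
        ((p : RLinearTriangulated.supp ρ) →
          RLinearTriangulated.LocalisingSubcategoryOf (RLinearTriangulated.gammaImage ρ p.1)),
      (∀ (S : RLinearTriangulated.LocalisingSubcategory T) (p : RLinearTriangulated.supp ρ),
        (σ S p).1 = S.1 ⊓ RLinearTriangulated.gammaImage ρ p.1) ∧
      (∀ F : (p : RLinearTriangulated.supp ρ) →
          RLinearTriangulated.LocalisingSubcategoryOf (RLinearTriangulated.gammaImage ρ p.1),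
        (σ.symm F).1 = RLinearTriangulated.loc (⨆ p, (F p).1)) := by
  open RLinearTriangulated in
  exact ⟨{
    toFun := fun S p => ⟨S.1 ⊓ gammaImage ρ p.1, S.2.inf (isLocalising_gammaImage ρ hT p.1),
      inf_le_right⟩
    invFun := fun F => ⟨loc (⨆ p, (F p).1), isLocalising_loc _⟩
    left_inv := fun S => Subtype.ext (loc_iSup_inf_gammaImage ρ hlg S.2)
    right_inv := fun F => funext fun p =>
      Subtype.ext (loc_iSup_inf_gammaImage_eq ρ hT hcomm F p)
    -- The order is reflected because `τ` is monotone and recovers `S` from its local pieces.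
    map_rel_iff' := fun {S S'} => ⟨fun h => by
      have h' : loc (⨆ p : supp ρ, S.1 ⊓ gammaImage ρ p.1) ≤
          loc (⨆ p : supp ρ, S'.1 ⊓ gammaImage ρ p.1) := loc_mono (iSup_mono h)
      rwa [loc_iSup_inf_gammaImage ρ hlg S.2, loc_iSup_inf_gammaImage ρ hlg S'.2] at h',
      fun h p X hX => ⟨h X hX.1, hX.2⟩⟩ },
    fun _ _ => rfl, fun _ => rfl⟩
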